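/- Let $S$ be a Hausdorff space with its Borel $\sigma$-field, let $X_1,X_2,\dots$ be i.i.d. $S$-valued random variables with law $\mathbf P$, and let $\widehat{\mathbf P}_n$ be the empirical measure of $X_1,\dots,X_n$. Given $\widehat{\mathbf P}_n$, let $X_1^*,\dots,X_{k_n}^*$ be i.i.d. with law $\widehat{\mathbf P}_n$ and let $\mathbf P^*_{k_n}$ be their empirical measure, where $k_n\to\infty$ and $k_n/n<c_0$ for all $n\ge 1$ and some constant $c_0<\infty$. For a set $\Theta$ of measurable functions $f:S\to\mathbb R$ let $\Lambda_{0\Theta}$ be the set of finite signed measures $\mathbf G$ on $S$ with $\mathbf G(S)=0$ and $\int|f|\,d|\mathbf G|<\infty$ for all $f\in\Theta$. Let $\tau_\Theta$ and $\sigma_\Theta$ be the coarsest topology and the smallest $\sigma$-algebra on $\Lambda_{0\Theta}$ for which all maps $\mathbf G\mapsto\int f\,d\mathbf G$, $f\in\Theta$, are continuous, respectively measurable. Put $\rho_0^2(\mathbf G,\mathbf P)=\frac12\int\left(\frac{d\mathbf G}{d\mathbf P}\right)^2d\mathbf P$ if $\mathbf G\ll\mathbf P$ and $\rho_0^2(\mathbf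 G,\mathbf P)=\infty$ otherwise, and $\rho_0^2(\Omega,\mathbf P)=\inf_{\mathbf G\in\Omega}\rho_0^2(\mathbf G,\mathbf P)$, with $\inf\emptyset=\infty$. For $\Omega_0\subset\Lambda_{0\Theta}$ and $a>0$, the conditional outer probability $(\widehat{\mathbf P}_n)^*(\mathbf P^*_{k_n}\in\widehat{\mathbf P}_n+a\Omega_0)$ is the infimum, over all $A\in\sigma_\Theta$ with $\Omega_0\subset A$, of the conditional probability of $\{\mathbf P^*_{k_n}\in\widehat{\mathbf P}_n+aA\}$ given $\widehat{\mathbf P}_n$; the inner probability is $(\widehat{\mathbf P}_n)_*(\mathbf P^*_{k_n}\in\widehat{\mathbf P}_n+a\Omega_0)=1-(\widehat{\mathbf P}_n)^*(\mathbf P^*_{k_n}\in\widehat{\mathbf P}_n+a(\Lambda_{0\Theta}\setminus\Omega_0))$. For extended real, not necessarily measurable $Z_n$, "$\liminf Z_n\ge c$ a.s.$_*$" means that there are measurable $\Delta_n\le Z_n$ with $\liminf\Delta_n\ge c$ almost surely, and "$\limsup Z_n\le c$ a.s.$^*$" means that $\liminf(-Z_n)\ge -c$ a.s.$_*$. Let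 $\Theta_0$ be the set of bounded measurable functions, and for $t>2$ let $\Theta_t$ be the set of measurable $f$ with $E|f(X_1)|^t<\infty$. For $h:(0,\infty)\to[0,\infty)$ let $\Theta_{2,h}$ be the set of measurable $f$ with $E|f(X_1)|^2<\infty$ and $\mathbf P(|f(X_1)|>s^{-1})<h(s)$ for all $s>0$. **Theorem.** Let $a_n>0$ be a nonincreasing sequence with $a_n\to0$, $a_{n+1}/a_n\to1$ and $k_na_n^2\to\infty$. Consider, for $\Omega_0\subset\Lambda_{0\Theta}$, the relations $$\liminf_{n\to\infty}(k_na_n^2)^{-1}\ln(\widehat{\mathbf P}_n)_*(\mathbf P^*_{k_n}\in\widehat{\mathbf P}_n+a_n\Omega_0)\ge-\rho_0^2(\mathrm{int}(\Omega_0),\mathbf P)\quad\text{a.s.}_*,\qquad(1)$$ $$\limsup_{n\to\infty}(k_na_n^2)^{-1}\ln(\widehat{\mathbf P}_n)^*(\mathbf P^*_{k_n}\in\widehat{\mathbf P}_n+a_n\Omega_0)\le-\rho_0^2(\mathrm{cl}(\Omega_0),\mathbf P)\quad\text{a.s.}^*,\qquad(2)$$ with $\ln 0=-\infty$ and with interior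 and closure in $\tau_\Theta$. (i) If $\sum_{n=1}^\infty h(ca_n)<\infty$ for every $c>0$, then (1) and (2) hold for every $\Omega_0\subset\Lambda_{0\Theta}$, both for $\Theta=\Theta_{2,h}$ and for $\Theta=\Theta_{2,h}\cup\Theta_0$. (ii) If $t>2$ and $a_n=o(n^{-1/t})$, then (1) and (2) hold for every $\Omega_0\subset\Lambda_{0\Theta}$ with $\Theta=\Theta_t$. -/

import Mathlib

/-!
Given the sample, the normalized deviation `D = (P* - P̂) / a` is linear in `f`, and
`E exp (k a² D f) = exp (k a² Λ f)` with `Λ f = a⁻² log P̂ (exp (a (f - P̂ f)))`. If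
`a n * max_{i < n} |f (X i)| → 0`, the second-order expansion of `exp` and the strong law for `f`
and `f²` give `Λ f → Var f / 2` almost surely. For the classes of the theorem the maxima are
negligible by the Borel–Cantelli lemma. Each bound involves only finitely many functionals, so the
exceptional sets are combined by working along a filter on samples, and it suffices to treat
countably many levels of the rate.

Upper bound: the sublevel sets of the rate are images of balls of `L²(P)`, hence weakly compact and
convex. A closed set disjoint from one of them stays at a positive distance from it in finitely many
coordinates, and there its complement is covered by finitely many half-spaces (Hahn–Banach and
compactness), each of which is estimated by Chernoff's inequality.

Lower bound: any `g ∈ L²(P)` has the same covariances with finitely many functions `f i` as some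
linear combination `u` of them with `Var u ≤ Var g`. Under the tilt by `exp (k a² D u)` the
`D (f i)` concentrate at `cov(f i, u)`. No change of measure is needed to see this: Chernoff's
inequality for `u ± η f i` shows that the complement of a small ball contributes negligibly to
`E exp (k a² D u)`.
-/

open MeasureTheory ProbabilityTheory Filter Topology
open scoped ENNReal NNReal

noncomputable section

namespace BootstrapMDP

variable {S : Type*} [MeasurableSpace S]

/-- The class `Θ₀` of all bounded measurable functions on `S`. -/
def boundedClass (S : Type*) [MeasurableSpace S] : Set (S → ℝ) :=
  {f | Measurable f ∧ ∃ C : ℝ, ∀ x, |f x| ≤ C}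

/-- The class `Θ_t` of measurable functions with `E |f(X)|^t < ∞`, where `X` has law `P`. -/
def momentClass (P : Measure S) (t : ℝ) : Set (S → ℝ) :=
  {f | Measurable f ∧ Integrable (fun x => |f x| ^ t) P}

/-- The class `Θ_{t,h}` of functions in `Θ_t` with `P(|f(X)| > s⁻¹) < h(s)` for all `s > 0`. -/
def tailClass (P : Measure S) (t : ℝ) (h : ℝ → ℝ) : Set (S → ℝ) :=
  {f | f ∈ momentClass P t ∧ ∀ s : ℝ, 0 < s → P.real {x | s⁻¹ < |f x|} < h s}

/-- The space `Λ_{0Θ}` of finite signed measures `G` on `S` with `G(S) = 0` and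
`∫ |f| d|G| < ∞` for every `f ∈ Θ`. -/
structure ZeroMassMeasure (Θ : Set (S → ℝ)) where
  /-- the underlying signed measure -/
  val : SignedMeasure S
  mass_eq_zero : val Set.univ = 0
  integrable : ∀ f ∈ Θ, Integrable f val.variation

/-- The family of evaluations `G ↦ ∫ f dG`, `f ∈ Θ`. -/
def evalMap (Θ : Set (S → ℝ)) (G : ZeroMassMeasure Θ) (f : Θ) : ℝ :=
  G.val.integral (f : S → ℝ) (ContinuousLinearMap.lsmul ℝ ℝ)

/-- The `τ_Θ`-topology: the coarsest one that makes every `G ↦ ∫ f dG`, `f ∈ Θ`, continuous. -/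
instance instTopologicalSpaceZeroMassMeasure (Θ : Set (S → ℝ)) :
    TopologicalSpace (ZeroMassMeasure Θ) :=
  TopologicalSpace.induced (evalMap Θ) inferInstance

/-- The `σ_Θ`-algebra: the smallest one that makes every `G ↦ ∫ f dG`, `f ∈ Θ`, measurable. -/
instance instMeasurableSpaceZeroMassMeasure (Θ : Set (S → ℝ)) :
    MeasurableSpace (ZeroMassMeasure Θ) :=
  MeasurableSpace.comap (evalMap Θ) inferInstance

open scoped Classical in
/-- The rate function `ρ₀²(G, P) = (1/2) ∫ (dG/dP)² dP` if `G ≪ P`, and `∞` otherwise. -/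
def rate (P : Measure S) (G : SignedMeasure S) : ℝ≥0∞ :=
  if G.variation ≪ P then 2⁻¹ * ∫⁻ x, ENNReal.ofReal (G.rnDeriv P x ^ 2) ∂P else ∞

/-- `ρ₀²(Ω₀, P) = inf {ρ₀²(G, P) : G ∈ Ω₀}`, which is `∞` for the empty set. -/
def rateSet (P : Measure S) {Θ : Set (S → ℝ)} (Ω₀ : Set (ZeroMassMeasure Θ)) : ℝ≥0∞ :=
  ⨅ G ∈ Ω₀, rate P G.val

/-- The empirical measure of the points `x 0, …, x (n - 1)`. -/
def empirical {n : ℕ} (x : Fin n → S) : Measure S :=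
  (n : ℝ≥0)⁻¹ • ∑ i, Measure.dirac (x i)

instance instIsFiniteMeasureEmpirical {n : ℕ} (x : Fin n → S) :
    IsFiniteMeasure (empirical x) := by
  unfold empirical
  infer_instance

/-- Given the sample `x` with empirical measure `P̂`, the event `P* ∈ P̂ + a A` for the empirical
measure `P*` of a bootstrap sample `y = (y₁, …, y_k)`. -/
def bootstrapEvent {Θ : Set (S → ℝ)} {n : ℕ} (x : Fin n → S) (k : ℕ) (a : ℝ)
    (A : Set (ZeroMassMeasure Θ)) : Set (Fin k → S) :=
  {y | ∃ G ∈ A,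
    (empirical y).toSignedMeasure = (empirical x).toSignedMeasure + a • G.val}

/-- The outer probability, with respect to `σ_Θ`, of `P* ∈ P̂ + a Ω₀` given the sample `x`: the
bootstrap sample consists of `k` independent variables with law `P̂ = empirical x`. -/
def bootstrapOuter {Θ : Set (S → ℝ)} {n : ℕ} (x : Fin n → S) (k : ℕ) (a : ℝ)
    (Ω₀ : Set (ZeroMassMeasure Θ)) : ℝ≥0∞ :=
  ⨅ (A : Set (ZeroMassMeasure Θ)) (_ : Ω₀ ⊆ A) (_ : MeasurableSet A),
    Measure.pi (fun _ : Fin k => empirical x) (bootstrapEvent x k a A)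

/-- The inner probability: one minus the outer probability of the complement in `Λ_{0Θ}`. -/
def bootstrapInner {Θ : Set (S → ℝ)} {n : ℕ} (x : Fin n → S) (k : ℕ) (a : ℝ)
    (Ω₀ : Set (ZeroMassMeasure Θ)) : ℝ≥0∞ :=
  1 - bootstrapOuter x k a Ω₀ᶜ

/-- `liminf Z_n ≥ c` inner almost surely, for `Z_n` that need not be measurable. -/
def LiminfGeInnerAS {Υ : Type*} [MeasurableSpace Υ] (μ : Measure Υ) (Z : ℕ → Υ → EReal)
    (c : EReal) : Prop :=
  ∃ Δ : ℕ → Υ → EReal, (∀ n, Measurable (Δ n)) ∧ (∀ n ω, Δ n ω ≤ Z n ω) ∧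
    ∀ᵐ ω ∂μ, c ≤ liminf (fun n => Δ n ω) atTop

/-- `limsup Z_n ≤ c` outer almost surely, i.e. `liminf (-Z_n) ≥ -c` inner almost surely. -/
def LimsupLeOuterAS {Υ : Type*} [MeasurableSpace Υ] (μ : Measure Υ) (Z : ℕ → Υ → EReal)
    (c : EReal) : Prop :=
  LiminfGeInnerAS μ (fun n ω => -Z n ω) (-c)

/-- The first `n` observations. -/
def sample {Υ : Type*} (X : ℕ → Υ → S) (n : ℕ) (ω : Υ) : Fin n → S := fun i => X i ω

/-- The almost sure conditional moderate deviation principle in the `τ_Θ`-topology for the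
bootstrap empirical measures of sizes `k n`, at speed `k n * (a n)²`. The logarithm takes values
in `[-∞, ∞]`, with `log 0 = -∞`. -/
def ConditionalMDP {Υ : Type*} [MeasurableSpace Υ] (μ : Measure Υ) (X : ℕ → Υ → S)
    (P : Measure S) (k : ℕ → ℕ) (a : ℕ → ℝ) (Θ : Set (S → ℝ)) : Prop :=
  ∀ Ω₀ : Set (ZeroMassMeasure Θ),
    LiminfGeInnerAS μ
      (fun n ω => (((k n * a n ^ 2)⁻¹ : ℝ) : EReal) *
        ENNReal.log (bootstrapInner (sample X n ω) (k n) (a n) Ω₀))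
      (-(rateSet P (interior Ω₀) : EReal)) ∧
    LimsupLeOuterAS μ
      (fun n ω => (((k n * a n ^ 2)⁻¹ : ℝ) : EReal) *
        ENNReal.log (bootstrapOuter (sample X n ω) (k n) (a n) Ω₀))
      (-(rateSet P (closure Ω₀) : EReal))

end BootstrapMDP

end

noncomputable section

namespace BootstrapMDP

theorem integral_toSignedMeasure_lsmul {S : Type*} [MeasurableSpace S] (m : Measure S)
    [IsFiniteMeasure m] (f : S → ℝ) :
    m.toSignedMeasure.integral f (ContinuousLinearMap.lsmul ℝ ℝ) = ∫ x, f x ∂m := by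
  have flip_lsmul : (ContinuousLinearMap.lsmul ℝ ℝ : ℝ →L[ℝ] ℝ →L[ℝ] ℝ).flip =
      ContinuousLinearMap.lsmul ℝ ℝ := by
    ext
    simp
  rw [← VectorMeasure.integral_toSignedMeasure (μ := m) (f := f), flip_lsmul]

section Density

variable {S : Type*} [MeasurableSpace S] {P : Measure S} {f g : S → ℝ}

theorem integrable_withDensity_enorm (hf : AEStronglyMeasurable f P) (hg : Integrable g P)
    (hfg : Integrable (fun x => f x * g x) P) :
    Integrable f (P.withDensity fun x => ‖g x‖ₑ) := by
  rw [integrable_withDensity_iff_integrable_smul₀' hg.1.enorm (by simp)]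
  refine hfg.mono ((hg.1.enorm.ennreal_toReal.aestronglyMeasurable).smul hf)
    (ae_of_all _ fun x => ?_)
  simp [mul_comm]

theorem integral_withDensityᵥ_lsmul (hf : AEStronglyMeasurable f P) (hg : Integrable g P)
    (hfg : Integrable (fun x => f x * g x) P) :
    (P.withDensityᵥ g).integral f (ContinuousLinearMap.lsmul ℝ ℝ) = ∫ x, f x * g x ∂P := by
  have hg_pos : AEMeasurable (fun x => ENNReal.ofReal (g x)) P := hg.1.aemeasurable.ennreal_ofReal
  have hg_neg : AEMeasurable (fun x => ENNReal.ofReal (-g x)) P :=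
    hg.1.aemeasurable.neg.ennreal_ofReal
  have hf_enorm := integrable_withDensity_enorm hf hg hfg
  have hf_pos : Integrable f (P.withDensity fun x => ENNReal.ofReal (g x)) :=
    hf_enorm.mono_measure (withDensity_mono (ae_of_all _ fun x => Real.ofReal_le_enorm (g x)))
  have hf_neg : Integrable f (P.withDensity fun x => ENNReal.ofReal (-g x)) :=
    hf_enorm.mono_measure (withDensity_mono (ae_of_all _ fun x => by
      simpa only [enorm_neg] using Real.ofReal_le_enorm (-g x)))
  have := isFiniteMeasure_withDensity_ofReal hg.2
  have : IsFiniteMeasure (P.withDensity fun x => ENNReal.ofReal (-g x)) :=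
    isFiniteMeasure_withDensity_ofReal hg.neg.2
  rw [withDensityᵥ_eq_withDensity_pos_part_sub_withDensity_neg_part hg,
    VectorMeasure.integral_sub_vectorMeasure (by simpa [VectorMeasure.Integrable] using hf_pos)
      (by simpa [VectorMeasure.Integrable] using hf_neg),
    integral_toSignedMeasure_lsmul, integral_toSignedMeasure_lsmul,
    integral_withDensity_eq_integral_toReal_smul₀ hg_pos (by simp),
    integral_withDensity_eq_integral_toReal_smul₀ hg_neg (by simp),
    ← integral_sub ((integrable_withDensity_iff_integrable_smul₀' hg_pos (by simp)).1 hf_pos)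
      ((integrable_withDensity_iff_integrable_smul₀' hg_neg (by simp)).1 hf_neg)]
  refine integral_congr_ae (ae_of_all _ fun x => ?_)
  simp only [smul_eq_mul, ENNReal.toReal_ofReal', ← sub_mul, max_zero_sub_max_neg_zero_eq_self]
  exact mul_comm _ _

theorem rate_withDensityᵥ [SigmaFinite P] (hg_int : Integrable g P) (hg : MemLp g 2 P) :
    rate P (P.withDensityᵥ g) = ENNReal.ofReal ((∫ x, g x ^ 2 ∂P) / 2) := by
  have hac : (P.withDensityᵥ g).variation ≪ P := by
    rw [Measure.variation_withDensityᵥ hg_int]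
    exact withDensity_absolutelyContinuous _ _
  have hrn : g =ᵐ[P] SignedMeasure.rnDeriv (P.withDensityᵥ g) P :=
    SignedMeasure.eq_rnDeriv 0 g hg_int VectorMeasure.MutuallySingular.zero_left (by simp)
  have hsq : ∫⁻ x, ENNReal.ofReal (SignedMeasure.rnDeriv (P.withDensityᵥ g) P x ^ 2) ∂P =
      ENNReal.ofReal (∫ x, g x ^ 2 ∂P) := by
    rw [ofReal_integral_eq_lintegral_ofReal hg.integrable_sq (ae_of_all _ fun _ => sq_nonneg _)]
    refine lintegral_congr_ae ?_
    filter_upwards [hrn] with x hx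
    rw [hx]
  rw [rate, if_pos hac, hsq, div_eq_inv_mul, ENNReal.ofReal_mul (by norm_num),
    ENNReal.ofReal_inv_of_pos (by norm_num), ENNReal.ofReal_ofNat]

end Density

section Rate

variable {S : Type*} [MeasurableSpace S] {P : Measure S} {Θ : Set (S → ℝ)}

theorem exists_withDensityᵥ_eq_of_rate_ne_top [SigmaFinite P] {G : SignedMeasure S}
    (hG : rate P G ≠ ∞) : ∃ g, Integrable g P ∧ MemLp g 2 P ∧ P.withDensityᵥ g = G := by
  have hac : G.variation ≪ P := by
    by_contra h
    exact hG (by rw [rate, if_neg h])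
  have hacᵥ : G ≪ᵥ P.toENNRealVectorMeasure := by
    refine VectorMeasure.AbsolutelyContinuous.mk fun s hs h => ?_
    rw [Measure.toENNRealVectorMeasure_apply_measurable hs] at h
    have := VectorMeasure.enorm_measure_le_variation G s
    rwa [hac h, nonpos_iff_eq_zero, enorm_eq_zero] at this
  have hm : Measurable (G.rnDeriv P) := SignedMeasure.measurable_rnDeriv _ _
  refine ⟨G.rnDeriv P, SignedMeasure.integrable_rnDeriv _ _, ?_,
    SignedMeasure.withDensityᵥ_rnDeriv_eq G P hacᵥ⟩
  refine (memLp_two_iff_integrable_sq hm.aestronglyMeasurable).2 ⟨by fun_prop, ?_⟩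
  rw [hasFiniteIntegral_iff_ofReal (ae_of_all _ fun x => sq_nonneg _), lt_top_iff_ne_top]
  intro h
  rw [rate, if_pos hac, h] at hG
  simp at hG

theorem integral_mul_eq_covariance [IsProbabilityMeasure P] {f g : S → ℝ} (hf : MemLp f 2 P)
    (hg : MemLp g 2 P) (hg_zero : ∫ x, g x ∂P = 0) : ∫ x, f x * g x ∂P = cov[f, g; P] := by
  rw [covariance_eq_sub hf hg, hg_zero, mul_zero, sub_zero]
  rfl

theorem exists_zeroMassMeasure_eq_covariance [IsProbabilityMeasure P]
    (hΘ : ∀ f ∈ Θ, MemLp f 2 P) {g : S → ℝ} (hg : MemLp g 2 P) :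
    ∃ G : ZeroMassMeasure Θ, (∀ f : Θ, evalMap Θ G f = cov[(f : S → ℝ), g; P]) ∧
      rate P G.val = ENNReal.ofReal (Var[g; P] / 2) := by
  set g₀ : S → ℝ := fun x => g x - ∫ x, g x ∂P with hg₀_def
  have hg₀ : MemLp g₀ 2 P := hg.sub (memLp_const _)
  have hg₀_int : Integrable g₀ P := hg₀.integrable (by norm_num)
  have hg_int : Integrable g P := hg.integrable (by norm_num)
  have hg₀_zero : ∫ x, g₀ x ∂P = 0 := by
    simp [hg₀_def, integral_sub hg_int (integrable_const _)]
  have hfg : ∀ f ∈ Θ, Integrable (fun x => f x * g₀ x) P := fun f hf =>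
    (hΘ f hf).integrable_mul hg₀
  refine ⟨⟨P.withDensityᵥ g₀, ?_, fun f hf => ?_⟩, fun f => ?_, ?_⟩
  · rw [withDensityᵥ_apply hg₀_int MeasurableSet.univ, setIntegral_univ, hg₀_zero]
  · rw [Measure.variation_withDensityᵥ hg₀_int]
    exact integrable_withDensity_enorm (hΘ f hf).1 hg₀_int (hfg f hf)
  · rw [evalMap, integral_withDensityᵥ_lsmul (hΘ f f.2).1 hg₀_int (hfg f f.2),
      integral_mul_eq_covariance (hΘ f f.2) hg₀ hg₀_zero, hg₀_def,
      covariance_sub_const_right hg_int]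
  · rw [rate_withDensityᵥ hg₀_int hg₀, ← variance_of_integral_eq_zero hg₀.1.aemeasurable hg₀_zero,
      hg₀_def, variance_sub_const hg.1]

theorem exists_memLp_evalMap_eq_covariance [IsProbabilityMeasure P] (hΘ : ∀ f ∈ Θ, MemLp f 2 P)
    {G : ZeroMassMeasure Θ} (hG : rate P G.val ≠ ∞) :
    ∃ g, MemLp g 2 P ∧ (∀ f : Θ, evalMap Θ G f = cov[(f : S → ℝ), g; P]) ∧
      rate P G.val = ENNReal.ofReal (Var[g; P] / 2) := by
  obtain ⟨g, hg_int, hg, hgG⟩ := exists_withDensityᵥ_eq_of_rate_ne_top hG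
  have hg_zero : ∫ x, g x ∂P = 0 := by
    rw [← setIntegral_univ, ← withDensityᵥ_apply hg_int MeasurableSet.univ, hgG, G.mass_eq_zero]
  refine ⟨g, hg, fun f => ?_, ?_⟩
  · rw [evalMap, ← hgG, integral_withDensityᵥ_lsmul (hΘ f f.2).1 hg_int
      ((hΘ f f.2).integrable_mul hg), integral_mul_eq_covariance (hΘ f f.2) hg hg_zero]
  · rw [← hgG, rate_withDensityᵥ hg_int hg,
      variance_of_integral_eq_zero hg.1.aemeasurable hg_zero]

end Rate

section Hilbert

variable {E ι : Type*} [NormedAddCommGroup E] [InnerProductSpace ℝ E]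

theorem isCompact_image_inner_closedBall [CompleteSpace E] (e : ι → E) (R : ℝ) :
    IsCompact ((fun g i => inner ℝ (e i) g) '' Metric.closedBall (0 : E) R) := by
  have hdual := (WeakDual.isCompact_closedBall (𝕜 := ℝ) (0 : StrongDual ℝ E) R).image
    (f := fun ℓ i => ℓ (e i)) (continuous_pi fun i => WeakDual.eval_continuous (e i))
  convert hdual using 1
  ext v
  constructor
  · rintro ⟨g, hg, rfl⟩
    refine ⟨StrongDual.toWeakDual (InnerProductSpace.toDual ℝ E g), ?_, ?_⟩
    · simpa using hg
    · ext i
      exact real_inner_comm (e i) g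
  · rintro ⟨ℓ, hℓ, rfl⟩
    refine ⟨(InnerProductSpace.toDual ℝ E).symm (WeakDual.toStrongDual ℓ), ?_, ?_⟩
    · simpa using hℓ
    · ext i
      exact (real_inner_comm _ _).trans InnerProductSpace.toDual_symm_apply

theorem convex_image_inner_closedBall (e : ι → E) (R : ℝ) :
    Convex ℝ ((fun g i => inner ℝ (e i) g) '' Metric.closedBall (0 : E) R) :=
  (convex_closedBall 0 R).linear_image (LinearMap.pi fun i => (innerSL ℝ (e i)).toLinearMap)

variable [Fintype ι]

theorem exists_combination_inner_eq (e : ι → E) (g : E) :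
    ∃ l : ι → ℝ, (∀ j, inner ℝ (e j) (∑ i, l i • e i) = inner ℝ (e j) g) ∧
      ‖∑ i, l i • e i‖ ≤ ‖g‖ := by
  set K := Submodule.span ℝ (Set.range e)
  have : FiniteDimensional ℝ K := FiniteDimensional.span_of_finite ℝ (Set.finite_range e)
  obtain ⟨l, hl⟩ := (Submodule.mem_span_range_iff_exists_fun ℝ).1
    (K.starProjection_apply_mem g)
  refine ⟨l, fun j => ?_, hl ▸ K.norm_starProjection_apply_le g⟩
  have horth := Submodule.starProjection_inner_eq_zero (K := K) g (e j)
    (Submodule.subset_span (Set.mem_range_self j))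
  rw [inner_sub_left, sub_eq_zero] at horth
  rw [hl, real_inner_comm, ← horth, real_inner_comm]

theorem mul_norm_sum_smul_le_of_forall_inner_le {e : ι → E} {R r : ℝ} (hR : 0 ≤ R) {l : ι → ℝ}
    (h : ∀ g ∈ Metric.closedBall (0 : E) R, ∑ i, l i * inner ℝ (e i) g ≤ r) :
    R * ‖∑ i, l i • e i‖ ≤ r := by
  set u := ∑ i, l i • e i with hu
  have hsum : ∀ g, ∑ i, l i * inner ℝ (e i) g = inner ℝ u g := fun g => by
    simp_rw [hu, sum_inner, real_inner_smul_left]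
  have hball : (R * ‖u‖⁻¹) • u ∈ Metric.closedBall (0 : E) R := by
    rw [mem_closedBall_zero_iff, norm_smul, norm_mul, norm_inv, norm_norm, Real.norm_of_nonneg hR,
      mul_assoc]
    exact mul_le_of_le_one_right hR (inv_mul_le_one_of_le₀ le_rfl (norm_nonneg u))
  calc R * ‖u‖ = R * ‖u‖⁻¹ * ‖u‖ ^ 2 := by
        rcases eq_or_ne ‖u‖ 0 with h0 | h0
        · simp [h0]
        · field_simp
    _ = inner ℝ u ((R * ‖u‖⁻¹) • u) := by rw [real_inner_smul_right, real_inner_self_eq_norm_sq]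
    _ ≤ r := hsum ((R * ‖u‖⁻¹) • u) ▸ h _ hball

theorem exists_norm_sum_smul_le_of_notMem_image_inner [CompleteSpace E] (e : ι → E) {R : ℝ}
    (hR : 0 < R) {w : ι → ℝ}
    (hw : w ∉ (fun g i => inner ℝ (e i) g) '' Metric.closedBall (0 : E) R) :
    ∃ l : ι → ℝ, ‖∑ i, l i • e i‖ ≤ R ∧ R ^ 2 < ∑ i, l i * w i := by
  classical
  obtain ⟨L, r, hLr, hrw⟩ := geometric_hahn_banach_closed_point
    (convex_image_inner_closedBall e R) (isCompact_image_inner_closedBall e R).isClosed hw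
  have hL : ∀ v, L v = ∑ i, L (Pi.single i 1) * v i := fun v => by
    conv_lhs => rw [pi_eq_sum_univ' v]
    simp only [map_sum, map_smul, smul_eq_mul, mul_comm]
  have hr : 0 < r := by simpa using hLr 0 ⟨0, by simpa using hR.le, by ext; simp⟩
  have hnorm : R * ‖∑ i, L (Pi.single i 1) • e i‖ ≤ r :=
    mul_norm_sum_smul_le_of_forall_inner_le hR.le fun g hg => by
      rw [← hL fun i => inner ℝ (e i) g]
      exact (hLr _ ⟨g, hg, rfl⟩).le
  refine ⟨fun i => R ^ 2 / r * L (Pi.single i 1), ?_, ?_⟩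
  · simp_rw [mul_smul, ← Finset.smul_sum]
    rw [norm_smul, Real.norm_of_nonneg (by positivity)]
    calc R ^ 2 / r * ‖∑ i, L (Pi.single i 1) • e i‖
        = R / r * (R * ‖∑ i, L (Pi.single i 1) • e i‖) := by ring
      _ ≤ R / r * r := by gcongr
      _ = R := div_mul_cancel₀ R hr.ne'
  · simp_rw [mul_assoc, ← Finset.mul_sum]
    rw [← hL]
    calc R ^ 2 = R ^ 2 / r * r := (div_mul_cancel₀ _ hr.ne').symm
      _ < R ^ 2 / r * L w := by gcongr

end Hilbert

theorem exists_finset_lt_of_notMem_thickening {E κ : Type*} [NormedAddCommGroup E]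
    [NormedSpace ℝ E] [ProperSpace E] {C : Set E} (hC : IsCompact C) (hC_zero : 0 ∈ C)
    (ℓ : κ → StrongDual ℝ E) {r : ℝ} (hr : 0 ≤ r) (hℓ : ∀ w ∉ C, ∃ j, r < ℓ j w) {ε : ℝ}
    (hε : 0 < ε) : ∃ T : Finset κ, ∀ w ∉ Metric.thickening ε C, ∃ j ∈ T, r < ℓ j w := by
  set K : Set E := {w | Metric.infDist w C = ε}
  have hK_compact : IsCompact K := by
    refine Metric.isCompact_of_isClosed_isBounded
      (isClosed_eq (Metric.continuous_infDist_pt C) continuous_const)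
      ((hC.isBounded.thickening (δ := ε + 1)).subset fun w hw => ?_)
    rw [Metric.mem_thickening_iff_infDist_lt ⟨0, hC_zero⟩, show Metric.infDist w C = ε from hw]
    exact lt_add_one ε
  obtain ⟨T, hT⟩ := hK_compact.elim_finite_subcover (fun j => {w | r < ℓ j w})
    (fun j => isOpen_lt continuous_const (ℓ j).continuous) fun w hw => by
      refine Set.mem_iUnion.2 (hℓ w fun hwC => hε.ne ?_)
      rw [← show Metric.infDist w C = ε from hw, Metric.infDist_zero_of_mem hwC]
  refine ⟨T, fun w hw => ?_⟩
  obtain ⟨s, ⟨hs_zero, hs_one⟩, hsw⟩ :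
      ε ∈ (fun s : ℝ => Metric.infDist (s • w) C) '' Set.Icc 0 1 := by
    refine intermediate_value_Icc zero_le_one (Continuous.continuousOn ?_) ⟨?_, ?_⟩
    · exact (Metric.continuous_infDist_pt C).comp (by fun_prop)
    · simpa [Metric.infDist_zero_of_mem hC_zero] using hε.le
    · rw [one_smul]
      exact not_lt.1 fun h => hw ((Metric.mem_thickening_iff_infDist_lt ⟨0, hC_zero⟩).2 h)
  obtain ⟨j, hj, hjs⟩ := Set.mem_iUnion₂.1 (hT hsw)
  have hs_mul : r < s * ℓ j w := by simpa using hjs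
  exact ⟨j, hj, hs_mul.trans_le (mul_le_of_le_one_left
    (pos_of_mul_pos_right (hr.trans_lt hs_mul) hs_zero).le hs_one)⟩

section Covariance

variable {S : Type*} [MeasurableSpace S] {P : Measure S} {ι : Type*} {f : ι → S → ℝ}

/-- The vectors of covariances `cov(f i, g)` for `g` of variance at most `2 * c`. For `f` the
identity family of a class `Θ` these are the evaluations on `Θ` of the zero mass measures of rate
at most `c`. -/
def rateSublevel (P : Measure S) (f : ι → S → ℝ) (c : ℝ) : Set (ι → ℝ) :=
  {v | ∃ g, MemLp g 2 P ∧ Var[g; P] ≤ 2 * c ∧ ∀ i, v i = cov[f i, g; P]}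

theorem image_restrict_rateSublevel (I : Finset ι) (f : ι → S → ℝ) (c : ℝ) :
    I.restrict '' rateSublevel P f c = rateSublevel P (fun i : I => f i) c := by
  ext v
  constructor
  · rintro ⟨w, ⟨g, hg, hgc, hw⟩, rfl⟩
    exact ⟨g, hg, hgc, fun i => hw i⟩
  · rintro ⟨g, hg, hgc, hv⟩
    exact ⟨fun i => cov[f i, g; P], ⟨g, hg, hgc, fun _ => rfl⟩, funext fun i => (hv i).symm⟩

variable [IsProbabilityMeasure P]

/-- The centring `g - E g` of a square integrable function, as an element of `L²(P)`. Covariances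
become inner products. -/
def centered (P : Measure S) [IsProbabilityMeasure P] {g : S → ℝ} (hg : MemLp g 2 P) : Lp ℝ 2 P :=
  (hg.sub (memLp_const (∫ s, g s ∂P))).toLp

theorem inner_centered {g : S → ℝ} (hg : MemLp g 2 P) (G : Lp ℝ 2 P) :
    inner ℝ (centered P hg) G = cov[g, G; P] := by
  have hg₀ : MemLp (fun s => g s - ∫ t, g t ∂P) 2 P := hg.sub (memLp_const _)
  have hg_int : Integrable g P := hg.integrable (by norm_num)
  have hg₀_zero : ∫ s, (g s - ∫ t, g t ∂P) ∂P = 0 := by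
    simp [integral_sub hg_int (integrable_const _)]
  rw [L2.inner_def, covariance_comm, ← covariance_sub_const_right hg_int (∫ s, g s ∂P),
    ← integral_mul_eq_covariance (Lp.memLp G) hg₀ hg₀_zero]
  refine integral_congr_ae ?_
  filter_upwards [hg₀.coeFn_toLp] with s hs
  rw [show centered P hg s = _ from hs]
  exact rfl

theorem inner_centered_centered {g h : S → ℝ} (hg : MemLp g 2 P) (hh : MemLp h 2 P) :
    inner ℝ (centered P hg) (centered P hh) = cov[g, h; P] := by
  rw [L2.inner_def, covariance]
  refine integral_congr_ae ?_
  filter_upwards [(hg.sub (memLp_const (∫ s, g s ∂P))).coeFn_toLp,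
    (hh.sub (memLp_const (∫ s, h s ∂P))).coeFn_toLp] with s hgs hhs
  rw [centered, centered, hgs, hhs]
  simp [mul_comm]

theorem norm_centered_sq {g : S → ℝ} (hg : MemLp g 2 P) : ‖centered P hg‖ ^ 2 = Var[g; P] := by
  rw [← real_inner_self_eq_norm_sq, inner_centered_centered, covariance_self hg.1.aemeasurable]

theorem variance_coeFn_le_norm_sq (G : Lp ℝ 2 P) : Var[G; P] ≤ ‖G‖ ^ 2 := by
  refine (variance_le_expectation_sq (Lp.aestronglyMeasurable G)).trans_eq ?_
  rw [← real_inner_self_eq_norm_sq, L2.inner_def]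
  simp [sq]

theorem rateSublevel_eq_image_inner (hf : ∀ i, MemLp (f i) 2 P) {c : ℝ} (hc : 0 ≤ c) :
    rateSublevel P f c =
      (fun g i => inner ℝ (centered P (hf i)) g) '' Metric.closedBall 0 √(2 * c) := by
  ext v
  simp only [Set.mem_image, mem_closedBall_zero_iff,
    Real.le_sqrt (norm_nonneg _) (mul_nonneg zero_le_two hc)]
  constructor
  · rintro ⟨g, hg, hgc, hv⟩
    refine ⟨centered P hg, (norm_centered_sq hg).trans_le hgc, funext fun i => ?_⟩
    rw [inner_centered_centered, hv]
  · rintro ⟨G, hG, rfl⟩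
    exact ⟨G, Lp.memLp G, (variance_coeFn_le_norm_sq G).trans hG, fun i => inner_centered _ G⟩

theorem isCompact_rateSublevel (hf : ∀ i, MemLp (f i) 2 P) {c : ℝ} (hc : 0 ≤ c) :
    IsCompact (rateSublevel P f c) := by
  rw [rateSublevel_eq_image_inner hf hc]
  exact isCompact_image_inner_closedBall _ _

variable [Fintype ι]

theorem sum_smul_centered (hf : ∀ i, MemLp (f i) 2 P) (l : ι → ℝ) :
    ∑ i, l i • centered P (hf i) =
      centered P (memLp_finsetSum' Finset.univ fun i _ => (hf i).const_smul (l i)) := by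
  refine ext_inner_right ℝ fun G => ?_
  simp_rw [sum_inner, real_inner_smul_left, inner_centered]
  rw [covariance_sum_left (fun i => (hf i).const_smul (l i)) (Lp.memLp G)]
  simp_rw [covariance_smul_left]

theorem exists_combination_covariance_eq (hf : ∀ i, MemLp (f i) 2 P) {g : S → ℝ}
    (hg : MemLp g 2 P) :
    ∃ l : ι → ℝ, (∀ j, cov[f j, ∑ i, l i • f i; P] = cov[f j, g; P]) ∧
      Var[∑ i, l i • f i; P] ≤ Var[g; P] := by
  obtain ⟨l, hl_inner, hl_norm⟩ :=
    exists_combination_inner_eq (fun i => centered P (hf i)) (centered P hg)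
  simp_rw [sum_smul_centered, inner_centered_centered] at hl_inner
  refine ⟨l, hl_inner, ?_⟩
  rw [← norm_centered_sq hg, ← norm_centered_sq (memLp_finsetSum' _ fun i _ =>
    (hf i).const_smul (l i)), ← sum_smul_centered hf]
  gcongr

theorem exists_variance_le_of_notMem_rateSublevel (hf : ∀ i, MemLp (f i) 2 P) {c : ℝ} (hc : 0 < c)
    {w : ι → ℝ} (hw : w ∉ rateSublevel P f c) :
    ∃ l : ι → ℝ, Var[∑ i, l i • f i; P] ≤ 2 * c ∧ 2 * c < ∑ i, l i * w i := by
  rw [rateSublevel_eq_image_inner hf hc.le] at hw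
  obtain ⟨l, hl_norm, hlw⟩ := exists_norm_sum_smul_le_of_notMem_image_inner _ (by positivity) hw
  rw [Real.sq_sqrt (by positivity)] at hlw
  rw [sum_smul_centered hf, Real.le_sqrt (norm_nonneg _) (by positivity), norm_centered_sq]
    at hl_norm
  exact ⟨l, hl_norm, hlw⟩

theorem exists_finset_lt_of_notMem_thickening_rateSublevel (hf : ∀ i, MemLp (f i) 2 P) {c ε : ℝ}
    (hc : 0 < c) (hε : 0 < ε) :
    ∃ T : Finset (ι → ℝ), (∀ l ∈ T, Var[∑ i, l i • f i; P] ≤ 2 * c) ∧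
      ∀ w ∉ Metric.thickening ε (rateSublevel P f c), ∃ l ∈ T, 2 * c < ∑ i, l i * w i := by
  classical
  have hzero : (0 : ι → ℝ) ∈ rateSublevel P f c :=
    ⟨0, MemLp.zero, by simpa using hc.le, fun i => (covariance_zero_right).symm⟩
  obtain ⟨T, hT⟩ := exists_finset_lt_of_notMem_thickening (isCompact_rateSublevel hf hc.le) hzero
    (fun l : {l : ι → ℝ // Var[∑ i, l i • f i; P] ≤ 2 * c} =>
      ∑ i, l.1 i • ContinuousLinearMap.proj (R := ℝ) (φ := fun _ : ι => ℝ) i)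
    (r := 2 * c) (by positivity) (fun w hw => by
      obtain ⟨l, hl, hlw⟩ := exists_variance_le_of_notMem_rateSublevel hf hc hw
      exact ⟨⟨l, hl⟩, by simpa using hlw⟩) hε
  refine ⟨T.image Subtype.val, ?_, fun w hw => ?_⟩
  · simpa using fun l hl _ => hl
  · obtain ⟨l, hl, hlw⟩ := hT w hw
    exact ⟨l, Finset.mem_image_of_mem _ hl, by simpa using hlw⟩

end Covariance

section SampleMean

variable {S : Type*} {n k : ℕ}

/-- The mean of a function over the points `x 0, …, x (n - 1)`, as a linear functional of the
function; it is `0` if `n = 0`. -/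
def sampleMean {n : ℕ} (x : Fin n → S) : (S → ℝ) →ₗ[ℝ] ℝ :=
  (n : ℝ)⁻¹ • ∑ i, LinearMap.proj (x i)

theorem sampleMean_apply (x : Fin n → S) (f : S → ℝ) :
    sampleMean x f = (∑ i, f (x i)) / n := by
  simp [sampleMean, div_eq_inv_mul]

theorem sampleMean_const [NeZero n] (x : Fin n → S) (c : ℝ) :
    sampleMean x (fun _ => c) = c := by
  simp [sampleMean_apply, NeZero.ne n]

theorem abs_sampleMean_le {x : Fin n → S} {f g : S → ℝ}
    (h : ∀ i, |f (x i)| ≤ g (x i)) : |sampleMean x f| ≤ sampleMean x g := by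
  rw [sampleMean_apply, sampleMean_apply, abs_div, Nat.abs_cast]
  gcongr
  exact (Finset.abs_sum_le_sum_abs _ _).trans (Finset.sum_le_sum fun i _ => h i)

theorem sampleMean_sub_sampleMean [NeZero n] (x : Fin n → S) (f : S → ℝ) :
    sampleMean x (fun s => f s - sampleMean x f) = 0 := by
  have := map_sub (sampleMean x) f fun _ => sampleMean x f
  rwa [sampleMean_const, sub_self] at this

theorem sampleMean_sub_sampleMean_sq [NeZero n] (x : Fin n → S) (f : S → ℝ) :
    sampleMean x (fun s => (f s - sampleMean x f) ^ 2) =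
      sampleMean x (f ^ 2) - sampleMean x f ^ 2 := by
  have hsq : (fun s => (f s - sampleMean x f) ^ 2) =
      f ^ 2 - (2 * sampleMean x f) • f + fun _ => sampleMean x f ^ 2 := by
    ext s
    simp only [Pi.add_apply, Pi.sub_apply, Pi.pow_apply, Pi.smul_apply, smul_eq_mul]
    ring
  rw [hsq, map_add, map_sub, map_smul, sampleMean_const, smul_eq_mul]
  ring

/-- The normalized deviation `(P* f - P̂ f) / a` between the empirical measures of the bootstrap
sample `y` and the sample `x`, as a linear functional of `f`. -/
def deviation {n k : ℕ} (x : Fin n → S) (a : ℝ) (y : Fin k → S) : (S → ℝ) →ₗ[ℝ] ℝ :=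
  a⁻¹ • (sampleMean y - sampleMean x)

theorem deviation_apply (x : Fin n → S) (a : ℝ) (y : Fin k → S) (f : S → ℝ) :
    deviation x a y f = (sampleMean y f - sampleMean x f) / a := by
  simp [deviation, div_eq_inv_mul]

/-- The cumulant generating function at `a` of `f`, centred at its mean, under the empirical
measure of `x`, scaled by `a ^ 2`. -/
def logMgf {n : ℕ} (x : Fin n → S) (a : ℝ) (f : S → ℝ) : ℝ :=
  Real.log (sampleMean x fun s => Real.exp (a * (f s - sampleMean x f))) / a ^ 2

theorem exp_deviation_eq_prod (x : Fin n → S) (a : ℝ) (y : Fin k → S) (f : S → ℝ) :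
    Real.exp (k * a ^ 2 * deviation x a y f) =
      ∏ j, Real.exp (a * (f (y j) - sampleMean x f)) := by
  rw [← Real.exp_sum, ← Finset.mul_sum, Finset.sum_sub_distrib, deviation_apply, sampleMean_apply y]
  congr 1
  rcases eq_or_ne a 0 with rfl | ha
  · simp
  rcases eq_or_ne k 0 with rfl | hk
  · simp
  simp only [Finset.sum_const, Finset.card_univ, Fintype.card_fin, nsmul_eq_mul]
  field_simp

variable [MeasurableSpace S] (x : Fin n → S)

theorem integrable_empirical {f : S → ℝ} (hf : Measurable f) : Integrable f (empirical x) :=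
  Integrable.smul_measure_nnreal (integrable_finsetSum_measure.2 fun _ _ =>
    integrable_dirac' hf.stronglyMeasurable (by simp))

theorem integral_empirical {f : S → ℝ} (hf : Measurable f) :
    ∫ s, f s ∂(empirical x) = sampleMean x f := by
  rw [empirical, integral_smul_nnreal_measure, integral_finsetSum_measure fun i _ =>
    integrable_dirac' hf.stronglyMeasurable (by simp)]
  simp_rw [integral_dirac' f _ hf.stronglyMeasurable]
  simp [sampleMean_apply, NNReal.smul_def, div_eq_inv_mul]

instance instIsProbabilityMeasureEmpirical [NeZero n] : IsProbabilityMeasure (empirical x) where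
  measure_univ := by
    have hn : (n : ℝ≥0) ≠ 0 := Nat.cast_ne_zero.2 (NeZero.ne n)
    simp only [empirical, Measure.smul_apply, Measure.finsetSum_apply, measure_univ,
      Finset.sum_const, Finset.card_univ, Fintype.card_fin, nsmul_eq_mul, mul_one]
    rw [ENNReal.smul_def, smul_eq_mul, ← ENNReal.coe_natCast, ← ENNReal.coe_mul,
      inv_mul_cancel₀ hn, ENNReal.coe_one]

@[fun_prop]
theorem measurable_deviation (a : ℝ) {f : S → ℝ} (hf : Measurable f) :
    Measurable fun y : Fin k → S => deviation x a y f := by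
  simp only [deviation_apply, sampleMean_apply]
  fun_prop

/-- The law of the bootstrap sample: `k` independent draws from the empirical measure of `x`. -/
abbrev bootstrapLaw (x : Fin n → S) (k : ℕ) : Measure (Fin k → S) :=
  Measure.pi fun _ => empirical x

theorem integrable_exp_deviation (a : ℝ) {f : S → ℝ} (hf : Measurable f) :
    Integrable (fun y => Real.exp (k * a ^ 2 * deviation x a y f)) (bootstrapLaw x k) := by
  simp_rw [exp_deviation_eq_prod]
  exact Integrable.fintype_prod (f := fun _ s => Real.exp (a * (f s - sampleMean x f)))
    fun _ => integrable_empirical x (by fun_prop)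

theorem integral_exp_deviation [NeZero n] (a : ℝ) {f : S → ℝ} (hf : Measurable f) :
    ∫ y, Real.exp (k * a ^ 2 * deviation x a y f) ∂(bootstrapLaw x k) =
      Real.exp (k * a ^ 2 * logMgf x a f) := by
  simp_rw [exp_deviation_eq_prod]
  rw [integral_fintype_prod_eq_pow (fun s => Real.exp (a * (f s - sampleMean x f))),
    integral_empirical x (by fun_prop), Fintype.card_fin, logMgf]
  rcases eq_or_ne a 0 with rfl | ha
  · simp [sampleMean_const]
  have hpos : 0 < sampleMean x fun s => Real.exp (a * (f s - sampleMean x f)) := by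
    rw [sampleMean_apply]
    exact div_pos (Finset.sum_pos (fun _ _ => Real.exp_pos _) Finset.univ_nonempty)
      (Nat.cast_pos.2 (Nat.pos_of_neZero n))
  rw [mul_assoc, mul_div_cancel₀ _ (pow_ne_zero 2 ha), Real.exp_nat_mul, Real.exp_log hpos]

theorem prob_le_deviation_le_exp [NeZero n] (a : ℝ) {f : S → ℝ} (hf : Measurable f) (r : ℝ) :
    (bootstrapLaw x k).real {y | r ≤ deviation x a y f} ≤
      Real.exp (k * a ^ 2 * (logMgf x a f - r)) := by
  have hchernoff := measure_ge_le_exp_mul_mgf (X := fun y => deviation x a y f) r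
    (t := k * a ^ 2) (by positivity) (integrable_exp_deviation x (k := k) a hf)
  rwa [mgf, integral_exp_deviation x a hf, ← Real.exp_add,
    show -(k * a ^ 2) * r + k * a ^ 2 * logMgf x a f = k * a ^ 2 * (logMgf x a f - r) by ring]
    at hchernoff

end SampleMean

section BootstrapEvent

variable {S : Type*} [MeasurableSpace S] {Θ : Set (S → ℝ)} {n k : ℕ} {x : Fin n → S} {a : ℝ}

theorem evalMap_eq_deviation (hΘ : ∀ f ∈ Θ, Measurable f) (ha : a ≠ 0) {y : Fin k → S}
    {G : ZeroMassMeasure Θ}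
    (hG : (empirical y).toSignedMeasure = (empirical x).toSignedMeasure + a • G.val) (f : Θ) :
    evalMap Θ G f = deviation x a y f := by
  have hf := hΘ f f.2
  have hval : G.val = a⁻¹ • ((empirical y).toSignedMeasure - (empirical x).toSignedMeasure) := by
    rw [hG, add_sub_cancel_left, inv_smul_smul₀ ha]
  have integrable_toSignedMeasure {m : ℕ} (z : Fin m → S) :
      VectorMeasure.Integrable (empirical z).toSignedMeasure (f : S → ℝ) := by
    simpa [VectorMeasure.Integrable] using integrable_empirical z hf
  rw [evalMap, hval, VectorMeasure.integral_smul_vectorMeasure,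
    VectorMeasure.integral_sub_vectorMeasure (integrable_toSignedMeasure y)
      (integrable_toSignedMeasure x), integral_toSignedMeasure_lsmul,
    integral_toSignedMeasure_lsmul, integral_empirical y hf, integral_empirical x hf]
  rfl

theorem bootstrapOuter_le (hΘ : ∀ f ∈ Θ, Measurable f) (ha : a ≠ 0) (I : Finset Θ)
    {B : Set (I → ℝ)} (hB : MeasurableSet B) {Ω₀ : Set (ZeroMassMeasure Θ)}
    (hΩ₀ : ∀ G ∈ Ω₀, I.restrict (evalMap Θ G) ∈ B) :
    bootstrapOuter x k a Ω₀ ≤ bootstrapLaw x k {y | (fun i : I => deviation x a y i) ∈ B} := by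
  refine (iInf₂_le {G | I.restrict (evalMap Θ G) ∈ B} hΩ₀).trans
    ((iInf_le _ ⟨I.restrict ⁻¹' B, Finset.measurable_restrict I hB, rfl⟩).trans
      (measure_mono ?_))
  rintro y ⟨G, hGB, hG⟩
  have : I.restrict (evalMap Θ G) = fun i : I => deviation x a y i :=
    funext fun i => evalMap_eq_deviation hΘ ha hG i
  rwa [Set.mem_ofPred_eq, ← this]

theorem le_bootstrapInner [NeZero n] (hΘ : ∀ f ∈ Θ, Measurable f) (ha : a ≠ 0) (I : Finset Θ)
    {B : Set (I → ℝ)} (hB : MeasurableSet B) {Ω₀ : Set (ZeroMassMeasure Θ)}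
    (hΩ₀ : ∀ G, I.restrict (evalMap Θ G) ∈ B → G ∈ Ω₀) :
    bootstrapLaw x k {y | (fun i : I => deviation x a y i) ∈ B} ≤ bootstrapInner x k a Ω₀ := by
  have hmeas : MeasurableSet {y : Fin k → S | (fun i : I => deviation x a y i) ∈ B} :=
    measurable_pi_lambda _ (fun i => measurable_deviation x a (hΘ _ i.1.2)) hB
  rw [← compl_compl {y : Fin k → S | _}, prob_compl_eq_one_sub hmeas.compl, bootstrapInner]
  exact tsub_le_tsub_left
    (bootstrapOuter_le hΘ ha I hB.compl fun G (hG : G ∉ Ω₀) h => hG (hΩ₀ G h)) 1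

end BootstrapEvent

section LogMgf

open Asymptotics

theorem abs_exp_sub_quadratic_le {t ε : ℝ} (ht : |t| ≤ ε) (hε : ε ≤ 1) :
    |Real.exp t - (1 + t + t ^ 2 / 2)| ≤ ε * t ^ 2 := by
  have hbound : |Real.exp t - (1 + t + t ^ 2 / 2)| ≤ |t| ^ 3 * (2 / 9) := by
    have := Real.exp_bound (ht.trans hε) (n := 3) (by norm_num)
    norm_num [Finset.sum_range_succ, Nat.factorial] at this
    exact this
  calc |Real.exp t - (1 + t + t ^ 2 / 2)| ≤ |t| * t ^ 2 * (2 / 9) := by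
        rwa [← sq_abs t, ← pow_succ', sq_abs]
    _ ≤ |t| * t ^ 2 := mul_le_of_le_one_right (by positivity) (by norm_num)
    _ ≤ ε * t ^ 2 := by gcongr

theorem abs_sampleMean_exp_sub_le {S : Type*} {n : ℕ} [NeZero n] (x : Fin n → S) {h : S → ℝ}
    {ε : ℝ} (hh : sampleMean x h = 0) (hε : ε ≤ 1) (hhε : ∀ i, |h (x i)| ≤ ε) :
    |sampleMean x (fun s => Real.exp (h s)) - 1 - sampleMean x (h ^ 2) / 2| ≤
      ε * sampleMean x (h ^ 2) := by
  have hmean := abs_sampleMean_le (x := x)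
    (f := (fun s => Real.exp (h s)) - ((fun _ => 1) + h + (2⁻¹ : ℝ) • h ^ 2))
    (g := ε • h ^ 2) fun i => by
      simpa [div_eq_inv_mul] using abs_exp_sub_quadratic_le (hhε i) hε
  simp only [map_sub, map_add, map_smul, sampleMean_const, hh, smul_eq_mul] at hmean
  convert hmean using 2
  ring

theorem abs_sampleMean_exp_centered_sub_le {S : Type*} {n : ℕ} [NeZero n] (x : Fin n → S) {a : ℝ}
    (ha : a ≠ 0) {f : S → ℝ} {ε : ℝ} (hε : ε ≤ 1) (hf : ∀ i, |a * f (x i)| ≤ ε / 2)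
    (hmean : |a * sampleMean x f| ≤ ε / 2) :
    |(sampleMean x (fun s => Real.exp (a * (f s - sampleMean x f))) - 1) / a ^ 2 -
        (sampleMean x (f ^ 2) - sampleMean x f ^ 2) / 2| ≤
      ε * (sampleMean x (f ^ 2) - sampleMean x f ^ 2) := by
  set h : S → ℝ := a • fun s => f s - sampleMean x f with h_def
  have hh : sampleMean x h = 0 := by
    rw [h_def, map_smul, sampleMean_sub_sampleMean, smul_zero]
  have hh_sq : sampleMean x (h ^ 2) = (sampleMean x (f ^ 2) - sampleMean x f ^ 2) * a ^ 2 := by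
    rw [h_def, smul_pow, map_smul, smul_eq_mul, mul_comm]
    exact congrArg (· * _) (sampleMean_sub_sampleMean_sq x f)
  have hh_le (i) : |h (x i)| ≤ ε := by
    have : h (x i) = a * f (x i) - a * sampleMean x f := mul_sub _ _ _
    rw [this]
    linarith [abs_sub (a * f (x i)) (a * sampleMean x f), hf i]
  have hbound := abs_sampleMean_exp_sub_le x hh hε hh_le
  rw [hh_sq, ← mul_assoc, mul_div_right_comm] at hbound
  have ha_sq : 0 < a ^ 2 := by positivity
  rw [div_sub' ha_sq.ne', abs_div, abs_of_pos ha_sq, div_le_iff₀ ha_sq, mul_comm (a ^ 2)]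
  exact hbound

variable {α : Type*} {l : Filter α}

theorem tendsto_log_div {E s : α → ℝ} {L : ℝ} (hs : Tendsto s l (𝓝 0)) (hs₀ : ∀ᶠ p in l, s p ≠ 0)
    (hE : Tendsto (fun p => (E p - 1) / s p) l (𝓝 L)) :
    Tendsto (fun p => Real.log (E p) / s p) l (𝓝 L) := by
  have hE₁ : Tendsto E l (𝓝 1) := by
    have : Tendsto (fun p => (E p - 1) / s p * s p + 1) l (𝓝 1) := by
      simpa using (hE.mul hs).add_const 1
    refine this.congr' ?_
    filter_upwards [hs₀] with p hp
    rw [div_mul_cancel₀ _ hp, sub_add_cancel]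
  have hslope : Tendsto (dslope Real.log 1) (𝓝 1) (𝓝 1) := by
    have := continuousAt_dslope_same.2 (Real.differentiableAt_log one_ne_zero)
    simpa [ContinuousAt] using this
  refine (((hslope.comp hE₁).mul hE).congr fun p => ?_).trans_eq (by rw [one_mul])
  rw [Function.comp_apply, ← mul_div_assoc, mul_comm, ← smul_eq_mul, sub_smul_dslope,
    Real.log_one, sub_zero]

variable {S : Type*} {n : α → ℕ} {x : ∀ p, Fin (n p) → S} {a : α → ℝ} {f : S → ℝ} {m q : ℝ}

theorem tendsto_logMgf (hn : ∀ᶠ p in l, n p ≠ 0) (ha : Tendsto a l (𝓝 0))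
    (ha₀ : ∀ᶠ p in l, a p ≠ 0) (hm : Tendsto (fun p => sampleMean (x p) f) l (𝓝 m))
    (hq : Tendsto (fun p => sampleMean (x p) (f ^ 2)) l (𝓝 q))
    (hmax : ∀ ε > 0, ∀ᶠ p in l, ∀ i, |a p * f (x p i)| ≤ ε) :
    Tendsto (fun p => logMgf (x p) (a p) f) l (𝓝 ((q - m ^ 2) / 2)) := by
  set V : α → ℝ := fun p => sampleMean (x p) (f ^ 2) - sampleMean (x p) f ^ 2
  set E : α → ℝ := fun p => sampleMean (x p) fun s => Real.exp (a p * (f s - sampleMean (x p) f))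
  have hV : Tendsto V l (𝓝 (q - m ^ 2)) := hq.sub (hm.pow 2)
  have hmean : Tendsto (fun p => |a p * sampleMean (x p) f|) l (𝓝 0) := by
    simpa using (ha.mul hm).abs
  have hremainder : (fun p => (E p - 1) / a p ^ 2 - V p / 2) =o[l] V := by
    refine isLittleO_iff.2 fun {c} hc => ?_
    have hε : 0 < min c 1 := by positivity
    filter_upwards [hn, ha₀, hmax _ (half_pos hε), hmean.eventually_le_const (half_pos hε)]
      with p hnp hap hmaxp hmeanp
    have : NeZero (n p) := ⟨hnp⟩
    calc |(E p - 1) / a p ^ 2 - V p / 2| ≤ min c 1 * V p :=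
          abs_sampleMean_exp_centered_sub_le (x p) hap (min_le_right c 1) hmaxp hmeanp
      _ ≤ min c 1 * |V p| := by gcongr; exact le_abs_self _
      _ ≤ c * |V p| := by gcongr; exact min_le_left c 1
  refine tendsto_log_div (by simpa using ha.pow 2) (ha₀.mono fun _ => pow_ne_zero 2) ?_
  have := ((hremainder.trans_isBigO (hV.isBigO_one ℝ)).tendsto_zero_of_tendsto
    tendsto_const_nhds).add (hV.div_const 2)
  simpa using this

end LogMgf

section NegligibleMaxima

/-- The condition `a n * max_{i < n} |z i| → 0`. -/
def NegligibleMaxima (a z : ℕ → ℝ) : Prop :=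
  Tendsto (fun p : Σ n : ℕ, Fin n => a p.1 * z p.2) (comap Sigma.fst atTop) (𝓝 0)

variable {a z : ℕ → ℝ}

theorem negligibleMaxima_iff :
    NegligibleMaxima a z ↔ ∀ ε > 0, ∀ᶠ n in atTop, ∀ i < n, |a n * z i| ≤ ε := by
  simp only [NegligibleMaxima, Metric.nhds_basis_closedBall.tendsto_right_iff, eventually_comap,
    mem_closedBall_zero_iff, Real.norm_eq_abs]
  refine forall₂_congr fun ε _ => eventually_congr (.of_forall fun n => ?_)
  exact ⟨fun h i hi => h ⟨n, ⟨i, hi⟩⟩ rfl, fun h p hp => hp ▸ h p.2 (hp ▸ p.2.2)⟩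

namespace NegligibleMaxima

theorem add {w : ℕ → ℝ} (hz : NegligibleMaxima a z) (hw : NegligibleMaxima a w) :
    NegligibleMaxima a fun i => z i + w i := by
  simpa [NegligibleMaxima, mul_add] using Tendsto.add hz hw

theorem const_mul (hz : NegligibleMaxima a z) (c : ℝ) :
    NegligibleMaxima a fun i => c * z i := by
  simpa [NegligibleMaxima, mul_left_comm] using Tendsto.const_mul c hz

theorem mono_isBigO {b : ℕ → ℝ} (hz : NegligibleMaxima b z) (hab : a =O[atTop] b) :
    NegligibleMaxima a z :=
  ((hab.comp_tendsto tendsto_comap).mul (Asymptotics.isBigO_refl _ _)).trans_tendsto hz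

theorem of_forall_abs_le {C : ℝ} (ha : Tendsto a atTop (𝓝 0)) (hz : ∀ i, |z i| ≤ C) :
    NegligibleMaxima a z :=
  (ha.comp tendsto_comap).zero_mul_isBoundedUnder_le
    ⟨C, eventually_map.2 (.of_forall fun p => hz p.2)⟩

theorem of_antitoneOn (ha : Tendsto a atTop (𝓝 0)) (ha_anti : AntitoneOn a (Set.Ici 1))
    (hz : ∀ ε > 0, ∀ᶠ i in atTop, a (i + 1) * |z i| ≤ ε) :
    NegligibleMaxima a z := by
  refine negligibleMaxima_iff.2 fun ε hε => ?_
  obtain ⟨N, hN⟩ := eventually_atTop.1 (hz ε hε)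
  have hearly : ∀ᶠ n in atTop, ∀ i < N, |a n * z i| ≤ ε := by
    refine (Set.finite_lt_nat N).eventually_all.2 fun i _ => ?_
    have : Tendsto (fun n => |a n * z i|) atTop (𝓝 0) := by simpa using (ha.mul_const (z i)).abs
    exact this.eventually_le_const hε
  filter_upwards [hearly] with n hn i hi
  rcases lt_or_ge i N with hiN | hNi
  · exact hn i hiN
  · have hn₁ : n ∈ Set.Ici 1 := Set.mem_Ici.2 (by lia)
    have ha_nonneg : 0 ≤ a n := le_of_tendsto ha
      ((eventually_ge_atTop n).mono fun m hm => ha_anti hn₁ (hn₁.trans hm) hm)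
    rw [abs_mul, abs_of_nonneg ha_nonneg]
    refine (mul_le_mul_of_nonneg_right ?_ (abs_nonneg _)).trans (hN i hNi)
    exact ha_anti (Set.mem_Ici.2 (by lia)) hn₁ hi

end NegligibleMaxima

end NegligibleMaxima

section Sampling

variable {S : Type*} [MeasurableSpace S] {P : Measure S} {Υ : Type*} [MeasurableSpace Υ]
  {μ : Measure Υ} {X : ℕ → Υ → S}

/-- The square integrable measurable functions whose maxima over the sample are almost surely
negligible with respect to the scale `a`. -/
def admissible (μ : Measure Υ) (X : ℕ → Υ → S) (P : Measure S) (a : ℕ → ℝ) :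
    Submodule ℝ (S → ℝ) where
  carrier := {f | Measurable f ∧ MemLp f 2 P ∧ ∀ᵐ ω ∂μ, NegligibleMaxima a fun i => f (X i ω)}
  add_mem' := fun ⟨hf, hf_memLp, hf_max⟩ ⟨hg, hg_memLp, hg_max⟩ =>
    ⟨hf.add hg, hf_memLp.add hg_memLp, by
      filter_upwards [hf_max, hg_max] with ω hfω hgω using hfω.add hgω⟩
  zero_mem' := ⟨measurable_zero, MemLp.zero, ae_of_all _ fun _ => by
    simp [NegligibleMaxima, tendsto_const_nhds]⟩
  smul_mem' := fun c _ ⟨hf, hf_memLp, hf_max⟩ =>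
    ⟨hf.const_smul c, hf_memLp.const_smul c, hf_max.mono fun _ h => h.const_mul c⟩

theorem ae_tendsto_sampleMean (hX : ∀ i, Measurable (X i))
    (hindep : Pairwise fun i j => X i ⟂ᵢ[μ] X j) (hlaw : ∀ i, μ.map (X i) = P) {f : S → ℝ}
    (hf : Measurable f) (hf_int : Integrable f P) :
    ∀ᵐ ω ∂μ, Tendsto (fun n => sampleMean (sample X n ω) f) atTop (𝓝 (∫ s, f s ∂P)) := by
  have hlln := strong_law_ae_real (μ := μ) (fun i ω => f (X i ω))
    ((hlaw 0 ▸ hf_int).comp_measurable (hX 0)) (fun i j hij => (hindep hij).comp hf hf)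
    (fun i => (⟨(hX i).aemeasurable, (hX 0).aemeasurable, by rw [hlaw, hlaw]⟩ :
      IdentDistrib (X i) (X 0) μ μ).comp hf)
  rw [← integral_map (hX 0).aemeasurable hf.aestronglyMeasurable, hlaw 0] at hlln
  filter_upwards [hlln] with ω hω
  refine hω.congr fun n => ?_
  rw [sampleMean_apply, ← Fin.sum_univ_eq_sum_range (fun i => f (X i ω)) n]
  rfl

@[fun_prop]
theorem measurable_sample (hX : ∀ i, Measurable (X i)) (n : ℕ) : Measurable (sample X n) :=
  measurable_pi_lambda _ fun i => hX i

@[fun_prop]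
theorem measurable_logMgf {n : ℕ} (a : ℝ) {f : S → ℝ} (hf : Measurable f) :
    Measurable fun x : Fin n → S => logMgf x a f := by
  simp only [logMgf, sampleMean_apply]
  fun_prop

theorem ae_tendsto_logMgf [IsProbabilityMeasure P] (hX : ∀ i, Measurable (X i))
    (hindep : Pairwise fun i j => X i ⟂ᵢ[μ] X j) (hlaw : ∀ i, μ.map (X i) = P) {a : ℕ → ℝ}
    (ha : Tendsto a atTop (𝓝 0)) (ha₀ : ∀ᶠ n in atTop, a n ≠ 0) {f : S → ℝ}
    (hf : f ∈ admissible μ X P a) :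
    ∀ᵐ ω ∂μ, Tendsto (fun n => logMgf (sample X n ω) (a n) f) atTop (𝓝 (Var[f; P] / 2)) := by
  obtain ⟨hf_meas, hf_memLp, hf_max⟩ := hf
  filter_upwards [hf_max, ae_tendsto_sampleMean hX hindep hlaw hf_meas
    (hf_memLp.integrable (by norm_num)), ae_tendsto_sampleMean hX hindep hlaw
    (hf_meas.pow_const 2) hf_memLp.integrable_sq] with ω hmax hmean hsq
  rw [variance_eq_sub hf_memLp]
  refine tendsto_logMgf (eventually_ne_atTop 0) ha ha₀ hmean hsq fun ε hε => ?_
  filter_upwards [negligibleMaxima_iff.1 hmax ε hε] with n hn i using hn i i.2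

/-- The filter of samples `⟨n, x⟩` whose size tends to infinity and whose functionals
`logMgf x (a n) f`, `f ∈ L`, tend to the limits `Var[f; P] / 2` that they have almost surely under
`P`. A property holding eventually along it holds for almost every sequence of observations from
some sample size on. -/
def typicalSamples (P : Measure S) (a : ℕ → ℝ) (L : Set (S → ℝ)) : Filter (Σ n : ℕ, Fin n → S) :=
  comap Sigma.fst atTop ⊓ ⨅ f ∈ L, comap (fun p => logMgf p.2 (a p.1) f) (𝓝 (Var[f; P] / 2))

theorem tendsto_fst_typicalSamples {a : ℕ → ℝ} {L : Set (S → ℝ)} :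
    Tendsto Sigma.fst (typicalSamples P a L) atTop :=
  tendsto_comap.mono_left inf_le_left

theorem tendsto_logMgf_typicalSamples {a : ℕ → ℝ} {L : Set (S → ℝ)} {f : S → ℝ} (hf : f ∈ L) :
    Tendsto (fun p : Σ n : ℕ, Fin n → S => logMgf p.2 (a p.1) f) (typicalSamples P a L)
      (𝓝 (Var[f; P] / 2)) :=
  tendsto_comap.mono_left (inf_le_right.trans (iInf₂_le f hf))

theorem isMeasurablyGenerated_comap {α β : Type*} [MeasurableSpace α] [MeasurableSpace β]
    {l : Filter β} [l.IsMeasurablyGenerated] {u : α → β} (hu : Measurable u) :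
    (comap u l).IsMeasurablyGenerated where
  exists_measurable_subset := by
    rintro _ ⟨t, ht, hts⟩
    obtain ⟨t', ht', ht'_meas, ht't⟩ := IsMeasurablyGenerated.exists_measurable_subset ht
    exact ⟨u ⁻¹' t', preimage_mem_comap ht', hu ht'_meas, (Set.preimage_mono ht't).trans hts⟩

theorem measurable_sigma {ι β : Type*} {α : ι → Type*} [∀ i, MeasurableSpace (α i)]
    [MeasurableSpace β] {u : (Σ i, α i) → β} (hu : ∀ i, Measurable fun s : α i => u ⟨i, s⟩) :
    Measurable u :=
  fun _ ht => MeasurableSpace.measurableSet_iInf.2 fun i => hu i ht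

theorem measurable_sigmaMk {ι : Type*} {α : ι → Type*} [∀ i, MeasurableSpace (α i)] (i : ι) :
    Measurable (Sigma.mk i : α i → Σ i, α i) :=
  fun _ ht => MeasurableSpace.measurableSet_iInf.1 ht i

theorem isMeasurablyGenerated_typicalSamples (P : Measure S) (a : ℕ → ℝ) {L : Set (S → ℝ)}
    (hL : ∀ f ∈ L, Measurable f) : (typicalSamples P a L).IsMeasurablyGenerated := by
  have hfst : Measurable (Sigma.fst : (Σ n : ℕ, Fin n → S) → ℕ) :=
    measurable_sigma fun _ => measurable_const
  have hlogMgf (f : L) : Measurable fun p : Σ n : ℕ, Fin n → S => logMgf p.2 (a p.1) f :=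
    measurable_sigma fun n => measurable_logMgf (a n) (hL f f.2)
  have := isMeasurablyGenerated_comap (l := atTop) hfst
  have (f : L) := isMeasurablyGenerated_comap (l := 𝓝 (Var[f; P] / 2)) (hlogMgf f)
  rw [typicalSamples, iInf_subtype']
  infer_instance

theorem ae_eventually_of_eventually_typicalSamples [IsProbabilityMeasure P]
    (hX : ∀ i, Measurable (X i)) (hindep : Pairwise fun i j => X i ⟂ᵢ[μ] X j)
    (hlaw : ∀ i, μ.map (X i) = P) {a : ℕ → ℝ} (ha : Tendsto a atTop (𝓝 0))
    (ha₀ : ∀ᶠ n in atTop, a n ≠ 0) {q : (Σ n : ℕ, Fin n → S) → Prop}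
    (hq : ∀ᶠ p in typicalSamples P a (admissible μ X P a), q p) :
    ∀ᵐ ω ∂μ, ∀ᶠ n in atTop, q ⟨n, sample X n ω⟩ := by
  set l : Filter (Σ n : ℕ, Fin n → S) :=
    (ae μ).bind fun ω => map (fun n => ⟨n, sample X n ω⟩) atTop
  have hle : l ≤ typicalSamples P a (admissible μ X P a) := by
    refine le_inf (map_le_iff_le_comap.1 ?_) (le_iInf₂ fun f hf => map_le_iff_le_comap.1 ?_)
    · exact fun s hs => ae_of_all _ fun _ => hs
    · exact fun s hs => (ae_tendsto_logMgf hX hindep hlaw ha ha₀ hf).mono fun ω hω => hω hs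
  exact hle hq

theorem liminfGeInnerAS_of_forall_lt {α : Type*} [MeasurableSpace α] {l : Filter α}
    [l.IsMeasurablyGenerated] {Y : ℕ → Υ → α} (hY : ∀ n, Measurable (Y n))
    (hl : ∀ s ∈ l, ∀ᵐ ω ∂μ, ∀ᶠ n in atTop, Y n ω ∈ s) {z : α → EReal} {c : EReal}
    (h : ∀ r : ℝ, (r : EReal) < c → ∀ᶠ p in l, (r : EReal) ≤ z p) :
    LiminfGeInnerAS μ (fun n ω => z (Y n ω)) c := by
  classical
  choose s hsl hs hsz using fun q : {q : ℚ // ((q : ℝ) : EReal) < c} =>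
    IsMeasurablyGenerated.exists_measurable_subset (h q q.2)
  set ζ : α → EReal := fun p => ⨆ q, if p ∈ s q then ((q : ℝ) : EReal) else ⊥
  have hζ : Measurable ζ :=
    .iSup fun q => .ite (hs q) measurable_const measurable_const
  refine ⟨fun n ω => ζ (Y n ω), fun n => hζ.comp (hY n), fun n ω => iSup_le fun q => ?_, ?_⟩
  · split_ifs with hq
    exacts [hsz q hq, bot_le]
  · filter_upwards [ae_all_iff.2 fun q => hl (s q) (hsl q)] with ω hω
    refine le_of_forall_lt_imp_le_of_dense fun b hb => ?_
    obtain ⟨q, hbq, hqc⟩ := EReal.exists_rat_btwn_of_lt hb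
    refine hbq.le.trans (le_liminf_of_le (by isBoundedDefault) ?_)
    filter_upwards [hω ⟨q, hqc⟩] with n hn
    exact le_iSup_of_le ⟨q, hqc⟩ (if_pos hn).ge

end Sampling

section Exponential

variable {α J : Type*} {l : Filter α} {t : α → ℝ}

theorem tendsto_sum_exp_mul_zero (ht : Tendsto t l atTop) {s : Finset J} {γ : J → α → ℝ}
    {R : J → ℝ} (hγ : ∀ j ∈ s, Tendsto (γ j) l (𝓝 (R j))) (hR : ∀ j ∈ s, R j < 0) :
    Tendsto (fun p => ∑ j ∈ s, Real.exp (t p * γ j p)) l (𝓝 0) := by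
  rw [← Finset.sum_const_zero (s := s)]
  exact tendsto_finsetSum s fun j hj =>
    Real.tendsto_exp_atBot.comp (ht.atTop_mul_neg (hR j hj) (hγ j hj))

theorem eventually_exp_neg_le_of_exp_le_add [Fintype J] (ht : Tendsto t l atTop) {β q : α → ℝ}
    {R B b : ℝ} {γ : J → α → ℝ} {R' : J → ℝ} (hβ : Tendsto β l (𝓝 R))
    (hγ : ∀ j, Tendsto (γ j) l (𝓝 (R' j))) (hR' : ∀ j, R' j < R) (hb : B - R < b)
    (hle : ∀ᶠ p in l, Real.exp (t p * β p) ≤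
      Real.exp (t p * B) * q p + ∑ j, Real.exp (t p * γ j p)) :
    ∀ᶠ p in l, Real.exp (-(t p * b)) ≤ q p := by
  have hsum := tendsto_sum_exp_mul_zero ht (s := Finset.univ) (fun j _ => (hγ j).sub hβ)
    fun j _ => sub_neg.2 (hR' j)
  have hfirst : Tendsto (fun p => Real.exp (t p * (B - β p - b))) l (𝓝 0) :=
    Real.tendsto_exp_atBot.comp
      (ht.atTop_mul_neg (by linarith) ((hβ.const_sub B).sub_const b))
  have hsmall := hfirst.add hsum
  rw [add_zero] at hsmall
  filter_upwards [hle, hsmall.eventually_le_const one_pos] with p hp hp_small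
  have hexp : Real.exp (t p * B) * Real.exp (-(t p * b)) + ∑ j, Real.exp (t p * γ j p) ≤
      Real.exp (t p * β p) := by
    calc _ = Real.exp (t p * β p) * (Real.exp (t p * (B - β p - b)) +
          ∑ j, Real.exp (t p * (γ j p - β p))) := by
          simp only [mul_add, Finset.mul_sum, ← Real.exp_add]
          ring_nf
      _ ≤ _ := mul_le_of_le_one_right (Real.exp_pos _).le hp_small
  exact le_of_mul_le_mul_left (by linarith) (Real.exp_pos (t p * B))

end Exponential

section Deviations

variable {S : Type*} [MeasurableSpace S] {J : Type*} [Fintype J]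

theorem exp_logMgf_le {n k : ℕ} [NeZero n] (x : Fin n → S) {a η B : ℝ} (hη : 0 ≤ η) {u : S → ℝ}
    {h : J → S → ℝ} (hu : Measurable u) (hh : ∀ j, Measurable (h j)) (r : J → ℝ)
    (hB : ∀ y : Fin k → S, (∀ j, deviation x a y (h j) < r j) → deviation x a y u ≤ B) :
    Real.exp (k * a ^ 2 * logMgf x a u) ≤
      Real.exp (k * a ^ 2 * B) *
          (bootstrapLaw x k).real {y | ∀ j, deviation x a y (h j) < r j} +
        ∑ j, Real.exp (k * a ^ 2 * (logMgf x a (u + η • h j) - η * r j)) := by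
  set A : Set (Fin k → S) := {y | ∀ j, deviation x a y (h j) < r j}
  have hA : MeasurableSet A := by
    simp only [A, Set.ofPred_forall]
    exact .iInter fun j => measurableSet_lt (measurable_deviation x a (hh j)) measurable_const
  have huh (j) : Measurable (u + η • h j) := hu.add ((hh j).const_smul η)
  have hpointwise (y) : Real.exp (k * a ^ 2 * deviation x a y u) ≤
      A.indicator (fun _ => Real.exp (k * a ^ 2 * B)) y +
        ∑ j, Real.exp (k * a ^ 2 * deviation x a y (u + η • h j)) *
          Real.exp (-(k * a ^ 2 * (η * r j))) := by
    by_cases hy : y ∈ A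
    · rw [Set.indicator_of_mem hy]
      refine le_add_of_le_of_nonneg ?_ (by positivity)
      gcongr
      exact hB y hy
    · rw [Set.indicator_of_notMem hy, zero_add]
      obtain ⟨j, hj⟩ : ∃ j, r j ≤ deviation x a y (h j) := by
        simpa only [A, Set.mem_ofPred_eq, not_forall, not_lt] using hy
      refine le_trans ?_ (Finset.single_le_sum (fun _ _ => by positivity) (Finset.mem_univ j))
      rw [← Real.exp_add, map_add, map_smul, smul_eq_mul, ← sub_eq_add_neg, ← mul_sub]
      gcongr
      linarith [mul_le_mul_of_nonneg_left hj hη]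
  have hint_A : Integrable (A.indicator fun _ => Real.exp (k * a ^ 2 * B)) (bootstrapLaw x k) :=
    (integrable_const _).indicator hA
  have hint (j) := (integrable_exp_deviation x (k := k) a (huh j)).mul_const
    (Real.exp (-(k * a ^ 2 * (η * r j))))
  have hmean := integral_mono (integrable_exp_deviation x a hu)
    (hint_A.add (integrable_finsetSum _ fun j _ => hint j)) hpointwise
  rw [integral_add' hint_A (integrable_finsetSum _ fun j _ => hint j),
    integral_indicator_const _ hA, integral_finsetSum _ fun j _ => hint j, smul_eq_mul,
    mul_comm (Measure.real _ A)] at hmean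
  simp only [integral_mul_const, integral_exp_deviation x a hu,
    integral_exp_deviation x a (huh _)] at hmean
  simpa only [← Real.exp_add, ← sub_eq_add_neg, ← mul_sub] using hmean

end Deviations

section TypicalSamples

theorem map_sum_smul_le {ι E : Type*} [Fintype ι] [AddCommGroup E] [Module ℝ E] (D : E →ₗ[ℝ] ℝ)
    (e : ι → E) (c : ι → ℝ) {v : ι → ℝ} {δ : ℝ} (hD : ∀ i, |D (e i) - v i| ≤ δ) :
    D (∑ i, c i • e i) ≤ ∑ i, c i * v i + δ * ∑ i, |c i| := by
  rw [Finset.mul_sum, ← Finset.sum_add_distrib, map_sum]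
  refine Finset.sum_le_sum fun i _ => ?_
  have hmul := (le_abs_self _).trans_eq (abs_mul (c i) (D (e i) - v i))
  rw [map_smul, smul_eq_mul]
  linarith [mul_le_mul_of_nonneg_left (hD i) (abs_nonneg (c i))]

theorem forall_map_sumElim_neg_lt_iff {ι E : Type*} [AddCommGroup E] [Module ℝ E] {D : E →ₗ[ℝ] ℝ}
    {f : ι → E} {m : ι → ℝ} {δ : ℝ} :
    (∀ j, D (Sum.elim f (-f) j) < Sum.elim (fun i => m i + δ) (fun i => -m i + δ) j) ↔
      ∀ i, |D (f i) - m i| < δ := by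
  simp only [Sum.forall, Sum.elim_inl, Sum.elim_inr, Pi.neg_apply, map_neg, abs_lt,
    ← forall_and]
  exact forall_congr' fun i =>
    ⟨fun ⟨_, _⟩ => ⟨by linarith, by linarith⟩, fun ⟨_, _⟩ => ⟨by linarith, by linarith⟩⟩

variable {S : Type*} [MeasurableSpace S] {P : Measure S} {a : ℕ → ℝ} {k : ℕ → ℕ}

theorem tendsto_speed_typicalSamples (hka : Tendsto (fun n => (k n : ℝ) * a n ^ 2) atTop atTop)
    {L : Set (S → ℝ)} :
    Tendsto (fun p : Σ n : ℕ, Fin n → S => (k p.1 : ℝ) * a p.1 ^ 2) (typicalSamples P a L)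
      atTop :=
  hka.comp tendsto_fst_typicalSamples

variable [IsProbabilityMeasure P]

theorem variance_add_smul {u h : S → ℝ} (hu : MemLp u 2 P) (hh : MemLp h 2 P) (η : ℝ) :
    Var[u + η • h; P] = Var[u; P] + η * (2 * cov[u, h; P] + η * Var[h; P]) := by
  rw [variance_add hu (hh.const_smul η), variance_smul, covariance_smul_right]
  ring

variable {L : Submodule ℝ (S → ℝ)} {ι : Type*}

theorem eventually_exp_le_prob_forall_deviation_lt [Finite ι]
    (hL : ∀ f ∈ L, Measurable f ∧ MemLp f 2 P)
    (hka : Tendsto (fun n => (k n : ℝ) * a n ^ 2) atTop atTop) {u : S → ℝ} {h : ι → S → ℝ}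
    {r : ι → ℝ} {B b : ℝ} (hu : u ∈ L) (hh : ∀ j, h j ∈ L) (hr : ∀ j, cov[u, h j; P] < r j)
    (hB : ∀ D : (S → ℝ) →ₗ[ℝ] ℝ, (∀ j, D (h j) < r j) → D u ≤ B) (hb : B - Var[u; P] / 2 < b) :
    ∀ᶠ p : Σ n : ℕ, Fin n → S in typicalSamples P a L,
      Real.exp (-(k p.1 * a p.1 ^ 2 * b)) ≤
        (bootstrapLaw p.2 (k p.1)).real {y | ∀ j, deviation p.2 (a p.1) y (h j) < r j} := by
  have := Fintype.ofFinite ι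
  obtain ⟨η, hη_pos, hη⟩ : ∃ η > 0, ∀ j, 2 * cov[u, h j; P] + η * Var[h j; P] < 2 * r j := by
    have hη (j) : ∀ᶠ η in 𝓝[>] (0 : ℝ), 2 * cov[u, h j; P] + η * Var[h j; P] < 2 * r j := by
      refine nhdsWithin_le_nhds (ContinuousAt.eventually_lt (by fun_prop) (by fun_prop) ?_)
      linarith [hr j]
    exact (eventually_mem_nhdsWithin.and (eventually_all.2 hη)).exists
  refine eventually_exp_neg_le_of_exp_le_add (tendsto_speed_typicalSamples hka)
    (tendsto_logMgf_typicalSamples hu) (fun j => (tendsto_logMgf_typicalSamples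
      (L.add_mem hu (L.smul_mem η (hh j)))).sub_const (η * r j)) (fun j => ?_) hb ?_
  · rw [variance_add_smul (hL u hu).2 (hL _ (hh j)).2]
    linarith [mul_lt_mul_of_pos_left (hη j) hη_pos]
  · filter_upwards [tendsto_fst_typicalSamples.eventually_ne_atTop 0] with p hp
    have : NeZero p.1 := ⟨hp⟩
    exact exp_logMgf_le p.2 hη_pos.le (hL u hu).1 (fun j => (hL _ (hh j)).1) r
      fun y hy => hB _ hy

theorem eventually_exp_le_prob_deviation_mem_ball [Fintype ι]
    (hL : ∀ f ∈ L, Measurable f ∧ MemLp f 2 P)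
    (hka : Tendsto (fun n => (k n : ℝ) * a n ^ 2) atTop atTop) {f : ι → S → ℝ}
    (hf : ∀ i, f i ∈ L) {g : S → ℝ} (hg : MemLp g 2 P) {b ε : ℝ} (hb : Var[g; P] / 2 < b)
    (hε : 0 < ε) :
    ∀ᶠ p : Σ n : ℕ, Fin n → S in typicalSamples P a L,
      Real.exp (-(k p.1 * a p.1 ^ 2 * b)) ≤
        (bootstrapLaw p.2 (k p.1)).real {y | (fun i => deviation p.2 (a p.1) y (f i)) ∈
          Metric.ball (fun i => cov[f i, g; P]) ε} := by
  obtain ⟨c, hc_cov, hc_var⟩ := exists_combination_covariance_eq (fun i => (hL _ (hf i)).2) hg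
  set u := ∑ i, c i • f i
  have hu : u ∈ L := L.sum_mem fun i _ => L.smul_mem _ (hf i)
  have hu_memLp := (hL u hu).2
  have hvar : ∑ i, c i * cov[f i, g; P] = Var[u; P] := by
    rw [← covariance_self hu_memLp.aemeasurable, covariance_sum_left (fun i =>
      (hL _ (hf i)).2.const_smul _) hu_memLp]
    simp only [covariance_smul_left, hc_cov]
  obtain ⟨δ, hδ_pos, hδε, hδ⟩ :
      ∃ δ > 0, δ < ε ∧ Var[u; P] + δ * ∑ i, |c i| - Var[u; P] / 2 < b := by
    have hδ : ∀ᶠ δ in 𝓝[>] (0 : ℝ), Var[u; P] + δ * ∑ i, |c i| - Var[u; P] / 2 < b := by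
      refine nhdsWithin_le_nhds (ContinuousAt.eventually_lt (by fun_prop) (by fun_prop) ?_)
      linarith
    exact (eventually_mem_nhdsWithin.and (((eventually_lt_nhds hε).filter_mono
      nhdsWithin_le_nhds).and hδ)).exists
  refine (eventually_exp_le_prob_forall_deviation_lt hL hka hu
    (h := Sum.elim f (-f)) (r := Sum.elim (fun i => cov[f i, g; P] + δ)
      fun i => -cov[f i, g; P] + δ)
    (Sum.forall.2 ⟨hf, fun i => L.neg_mem (hf i)⟩) (Sum.forall.2 ⟨fun i => ?_, fun i => ?_⟩)
    (fun D hD => ?_) hδ).mono fun p hp =>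
      hp.trans (measureReal_mono fun y hy => (dist_pi_lt_iff hε).2 fun i => ?_)
  · simpa only [Sum.elim_inl, covariance_comm u, hc_cov] using lt_add_of_pos_right _ hδ_pos
  · simpa only [Sum.elim_inr, Pi.neg_apply, covariance_comm u, covariance_neg_left, hc_cov] using
      lt_add_of_pos_right _ hδ_pos
  · rw [← hvar]
    exact map_sum_smul_le D f c fun i => (forall_map_sumElim_neg_lt_iff.1 hD i).le
  · exact (Real.dist_eq _ _).trans_lt ((forall_map_sumElim_neg_lt_iff.1 hy i).trans hδε)

theorem eventually_prob_deviation_notMem_thickening_le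
    (hL : ∀ f ∈ L, Measurable f ∧ MemLp f 2 P)
    (hka : Tendsto (fun n => (k n : ℝ) * a n ^ 2) atTop atTop) [Fintype ι] {f : ι → S → ℝ}
    (hf : ∀ i, f i ∈ L) {b c ε : ℝ} (hc : 0 < c) (hbc : b < c) (hε : 0 < ε) :
    ∀ᶠ p : Σ n : ℕ, Fin n → S in typicalSamples P a L,
      (bootstrapLaw p.2 (k p.1)).real {y |
          (fun i => deviation p.2 (a p.1) y (f i)) ∉ Metric.thickening ε (rateSublevel P f c)} ≤
        Real.exp (-(k p.1 * a p.1 ^ 2 * b)) := by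
  obtain ⟨T, hT_var, hT⟩ :=
    exists_finset_lt_of_notMem_thickening_rateSublevel (fun i => (hL _ (hf i)).2) hc hε
  set u : (ι → ℝ) → S → ℝ := fun l => ∑ i, l i • f i
  have hu (l) : u l ∈ L := L.sum_mem fun i _ => L.smul_mem _ (hf i)
  have hsum := tendsto_sum_exp_mul_zero (tendsto_speed_typicalSamples (P := P) hka) (s := T)
    (fun l _ => ((tendsto_logMgf_typicalSamples (hu l)).sub_const (2 * c)).add_const b)
    (fun l hl => by linarith [show Var[u l; P] ≤ 2 * c from hT_var l hl])
  filter_upwards [hsum.eventually_le_const one_pos,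
    tendsto_fst_typicalSamples.eventually_ne_atTop 0] with p hp hp₀
  have : NeZero p.1 := ⟨hp₀⟩
  set t : ℝ := k p.1 * a p.1 ^ 2
  calc _ ≤ (bootstrapLaw p.2 (k p.1)).real
          (⋃ l ∈ T, {y | 2 * c ≤ deviation p.2 (a p.1) y (u l)}) := by
        refine measureReal_mono (fun y hy => ?_) (measure_ne_top _ _)
        obtain ⟨l, hl, hlt⟩ := hT _ hy
        refine Set.mem_biUnion hl (Set.mem_ofPred.2 (hlt.le.trans_eq ?_))
        simp only [u, map_sum, map_smul, smul_eq_mul]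
    _ ≤ ∑ l ∈ T, Real.exp (t * (logMgf p.2 (a p.1) (u l) - 2 * c)) :=
        (measureReal_biUnion_finset_le _ _).trans (Finset.sum_le_sum fun l _ =>
          prob_le_deviation_le_exp p.2 (a p.1) (hL _ (hu l)).1 _)
    _ = Real.exp (-(t * b)) *
          ∑ l ∈ T, Real.exp (t * (logMgf p.2 (a p.1) (u l) - 2 * c + b)) := by
        rw [Finset.mul_sum]
        refine Finset.sum_congr rfl fun l _ => ?_
        rw [← Real.exp_add]
        ring_nf
    _ ≤ _ := mul_le_of_le_one_right (Real.exp_pos _).le hp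

end TypicalSamples

section Topology

variable {ι E : Type*} [PseudoMetricSpace E]

open scoped Uniformity in
theorem exists_finset_dist_restrict_lt_of_mem_uniformity {V : Set ((ι → E) × (ι → E))}
    (hV : V ∈ 𝓤 (ι → E)) :
    ∃ I : Finset ι, ∃ δ > 0, ∀ v w : ι → E, dist (I.restrict v) (I.restrict w) < δ →
      (v, w) ∈ V := by
  rw [Pi.uniformity, mem_iInf_finite] at hV
  obtain ⟨I, hI⟩ := hV
  have hcomap : ⨅ i ∈ I, comap (fun p : (ι → E) × (ι → E) => (p.1 i, p.2 i)) (𝓤 E) =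
      comap (fun p => (I.restrict p.1, I.restrict p.2)) (𝓤 (I → E)) := by
    simp only [Pi.uniformity, comap_iInf, comap_comap, iInf_subtype]
    rfl
  rw [hcomap, (Metric.uniformity_basis_dist.comap _).mem_iff] at hI
  obtain ⟨δ, hδ, hsub⟩ := hI
  exact ⟨I, δ, hδ, fun v w hvw => hsub hvw⟩

theorem exists_finset_restrict_notMem_thickening {C D : Set (ι → E)} (hC : IsCompact C)
    (hD : IsClosed D) (hCD : Disjoint C D) :
    ∃ I : Finset ι, ∃ ε > 0, ∀ w ∈ D, I.restrict w ∉ Metric.thickening ε (I.restrict '' C) := by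
  obtain ⟨V, hV, hdisj⟩ := hCD.exists_uniform_thickening hC hD
  obtain ⟨I, ε, hε, hI⟩ := exists_finset_dist_restrict_lt_of_mem_uniformity hV
  refine ⟨I, ε, hε, fun w hw hmem => ?_⟩
  obtain ⟨_, ⟨v, hv, rfl⟩, hvw⟩ := Metric.mem_thickening_iff.1 hmem
  rw [dist_comm] at hvw
  exact Set.disjoint_left.1 hdisj (Set.mem_biUnion hv (hI v w hvw))
    (Set.mem_biUnion hw (refl_mem_uniformity hV))

end Topology

section LogScale

variable {t b : ℝ} {p : ℝ≥0∞}

theorem inv_mul_log_ofReal_exp (ht : t ≠ 0) (b : ℝ) :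
    ((t⁻¹ : ℝ) : EReal) * ENNReal.log (ENNReal.ofReal (Real.exp (t * b))) = b := by
  rw [ENNReal.log_ofReal_of_pos (Real.exp_pos _), Real.log_exp, ← EReal.coe_mul,
    inv_mul_cancel_left₀ ht]

theorem le_inv_mul_log (ht : 0 < t) (h : ENNReal.ofReal (Real.exp (t * b)) ≤ p) :
    (b : EReal) ≤ ((t⁻¹ : ℝ) : EReal) * ENNReal.log p := by
  rw [← inv_mul_log_ofReal_exp ht.ne' b]
  exact mul_le_mul_of_nonneg_left (ENNReal.log_le_log h)
    (EReal.coe_nonneg.2 (inv_nonneg.2 ht.le))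

theorem inv_mul_log_le (ht : 0 < t) (h : p ≤ ENNReal.ofReal (Real.exp (t * b))) :
    ((t⁻¹ : ℝ) : EReal) * ENNReal.log p ≤ (b : EReal) := by
  rw [← inv_mul_log_ofReal_exp ht.ne' b]
  exact mul_le_mul_of_nonneg_left (ENNReal.log_le_log h)
    (EReal.coe_nonneg.2 (inv_nonneg.2 ht.le))

end LogScale

section ModerateDeviations

variable {S : Type*} [MeasurableSpace S] {P : Measure S}

theorem exists_mem_rate_lt_of_lt_neg_rateSet {Θ : Set (S → ℝ)} {U : Set (ZeroMassMeasure Θ)}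
    {r : ℝ} (hr : (r : EReal) < -(rateSet P U : EReal)) :
    ∃ G ∈ U, rate P G.val < ENNReal.ofReal (-r) := by
  have hrate : rateSet P U < ENNReal.ofReal (-r) := by
    rw [← EReal.coe_ennreal_lt_coe_ennreal_iff, EReal.coe_ennreal_ofReal]
    refine (EReal.lt_neg_comm.1 hr).trans_le ?_
    rw [← EReal.coe_neg]
    exact EReal.coe_le_coe (le_max_left _ _)
  simpa only [rateSet, iInf_lt_iff, exists_prop] using hrate

variable [IsProbabilityMeasure P] {a : ℕ → ℝ} {k : ℕ → ℕ} {L : Submodule ℝ (S → ℝ)}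
  {Θ : Set (S → ℝ)}

theorem eventually_le_log_bootstrapInner (hL : ∀ f ∈ L, Measurable f ∧ MemLp f 2 P)
    (hΘ : Θ ⊆ L) (hka : Tendsto (fun n => (k n : ℝ) * a n ^ 2) atTop atTop)
    {Ω₀ : Set (ZeroMassMeasure Θ)} {r : ℝ}
    (hr : (r : EReal) < -(rateSet P (interior Ω₀) : EReal)) :
    ∀ᶠ p : Σ n : ℕ, Fin n → S in typicalSamples P a L,
      (r : EReal) ≤ (((k p.1 * a p.1 ^ 2)⁻¹ : ℝ) : EReal) *
        ENNReal.log (bootstrapInner p.2 (k p.1) (a p.1) Ω₀) := by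
  obtain ⟨G, hG, hGr⟩ := exists_mem_rate_lt_of_lt_neg_rateSet hr
  obtain ⟨g, hg, hGg, hgr⟩ := exists_memLp_evalMap_eq_covariance
    (fun f hf => (hL f (hΘ hf)).2) (hGr.trans ENNReal.ofReal_lt_top).ne
  rw [hgr, ENNReal.ofReal_lt_ofReal_iff_of_nonneg (by positivity [variance_nonneg g P])] at hGr
  obtain ⟨V, hV, hVΩ₀⟩ := (mem_nhds_induced _ _ _).1 (mem_interior_iff_mem_nhds.1 hG)
  obtain ⟨W, hW, hWV⟩ := UniformSpace.mem_nhds_iff.1 hV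
  obtain ⟨I, δ, hδ, hI⟩ := exists_finset_dist_restrict_lt_of_mem_uniformity hW
  have hball (H : ZeroMassMeasure Θ)
      (hH : I.restrict (evalMap Θ H) ∈ Metric.ball (fun i : I => cov[i, g; P]) δ) : H ∈ Ω₀ := by
    rw [← funext fun i : I => hGg i, Metric.mem_ball'] at hH
    exact hVΩ₀ (hWV (hI _ _ hH))
  filter_upwards [eventually_exp_le_prob_deviation_mem_ball hL hka (f := fun i : I => i)
    (fun i => hΘ i.1.2) hg hGr hδ, (tendsto_speed_typicalSamples hka).eventually_gt_atTop 0,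
    tendsto_fst_typicalSamples.eventually_ne_atTop 0] with p hp ht hp₀
  have : NeZero p.1 := ⟨hp₀⟩
  have ha : a p.1 ≠ 0 := pow_ne_zero_iff two_ne_zero |>.1 (right_ne_zero_of_mul ht.ne')
  refine le_inv_mul_log ht (le_trans ?_ (le_bootstrapInner (fun f hf => (hL f (hΘ hf)).1) ha I
    Metric.isOpen_ball.measurableSet hball))
  rw [← ofReal_measureReal]
  exact ENNReal.ofReal_le_ofReal (by simpa using hp)

theorem disjoint_rateSublevel_closure_image (hΘ : ∀ f ∈ Θ, MemLp f 2 P)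
    {Ω₀ : Set (ZeroMassMeasure Θ)} {c : ℝ}
    (hc : ENNReal.ofReal c < rateSet P (closure Ω₀)) :
    Disjoint (rateSublevel P (fun f : Θ => (f : S → ℝ)) c) (closure (evalMap Θ '' Ω₀)) := by
  rw [Set.disjoint_left]
  rintro v ⟨g, hg, hgc, hv⟩ hcl
  obtain ⟨G, hGg, hGr⟩ := exists_zeroMassMeasure_eq_covariance hΘ hg
  obtain rfl : v = evalMap Θ G := funext fun f => (hv f).trans (hGg f).symm
  have hG : G ∈ closure Ω₀ := closure_induced.2 hcl
  refine ((iInf₂_le G hG).trans_lt' hc).not_ge (hGr.trans_le ?_)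
  exact ENNReal.ofReal_le_ofReal (by linarith)

theorem exists_measurableSet_eventually_prob_deviation_mem_le
    (hL : ∀ f ∈ L, Measurable f ∧ MemLp f 2 P) (hΘ : Θ ⊆ L)
    (hka : Tendsto (fun n => (k n : ℝ) * a n ^ 2) atTop atTop)
    {Ω₀ : Set (ZeroMassMeasure Θ)} {r : ℝ}
    (hr : (r : EReal) < (rateSet P (closure Ω₀) : EReal)) :
    ∃ (I : Finset Θ) (B : Set (I → ℝ)), MeasurableSet B ∧
      (∀ G ∈ Ω₀, I.restrict (evalMap Θ G) ∈ B) ∧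
      ∀ᶠ p : Σ n : ℕ, Fin n → S in typicalSamples P a L,
        (bootstrapLaw p.2 (k p.1)).real {y | (fun i : I => deviation p.2 (a p.1) y i) ∈ B} ≤
          Real.exp (-(k p.1 * a p.1 ^ 2 * r)) := by
  have hΘ_memLp : ∀ f ∈ Θ, MemLp f 2 P := fun f hf => (hL f (hΘ hf)).2
  rcases lt_or_ge r 0 with hr_neg | hr_nonneg
  · refine ⟨∅, Set.univ, .univ, fun _ _ => Set.mem_univ _, ?_⟩
    filter_upwards [(tendsto_speed_typicalSamples hka).eventually_gt_atTop 0,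
      tendsto_fst_typicalSamples.eventually_ne_atTop 0] with p ht hp₀
    have : NeZero p.1 := ⟨hp₀⟩
    exact measureReal_le_one.trans
      (Real.one_le_exp (neg_nonneg.2 (mul_nonpos_of_nonneg_of_nonpos ht.le hr_neg.le)))
  · obtain ⟨c, hrc, hc⟩ := EReal.exists_rat_btwn_of_lt hr
    have hrc : r < c := EReal.coe_lt_coe_iff.1 hrc
    have hc_pos : (0 : ℝ) < c := hr_nonneg.trans_lt hrc
    rw [← max_eq_left hc_pos.le, ← EReal.coe_ennreal_ofReal,
      EReal.coe_ennreal_lt_coe_ennreal_iff] at hc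
    obtain ⟨I, ε, hε, hI⟩ := exists_finset_restrict_notMem_thickening
      (isCompact_rateSublevel (fun f : Θ => hΘ_memLp f f.2) hc_pos.le) isClosed_closure
      (disjoint_rateSublevel_closure_image hΘ_memLp hc)
    rw [image_restrict_rateSublevel] at hI
    exact ⟨I, (Metric.thickening ε (rateSublevel P (fun i : I => i) c))ᶜ,
      Metric.isOpen_thickening.measurableSet.compl,
      fun G hG => hI _ (subset_closure (Set.mem_image_of_mem _ hG)),
      eventually_prob_deviation_notMem_thickening_le hL hka (fun i => hΘ i.1.2) hc_pos hrc hε⟩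

theorem eventually_log_bootstrapOuter_le (hL : ∀ f ∈ L, Measurable f ∧ MemLp f 2 P)
    (hΘ : Θ ⊆ L) (hka : Tendsto (fun n => (k n : ℝ) * a n ^ 2) atTop atTop)
    {Ω₀ : Set (ZeroMassMeasure Θ)} {r : ℝ}
    (hr : (r : EReal) < (rateSet P (closure Ω₀) : EReal)) :
    ∀ᶠ p : Σ n : ℕ, Fin n → S in typicalSamples P a L,
      (((k p.1 * a p.1 ^ 2)⁻¹ : ℝ) : EReal) *
        ENNReal.log (bootstrapOuter p.2 (k p.1) (a p.1) Ω₀) ≤ ((-r : ℝ) : EReal) := by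
  obtain ⟨I, B, hB, hΩ₀, hprob⟩ :=
    exists_measurableSet_eventually_prob_deviation_mem_le hL hΘ hka hr
  filter_upwards [hprob, (tendsto_speed_typicalSamples hka).eventually_gt_atTop 0,
    tendsto_fst_typicalSamples.eventually_ne_atTop 0] with p hp ht hp₀
  have : NeZero p.1 := ⟨hp₀⟩
  have ha : a p.1 ≠ 0 := pow_ne_zero_iff two_ne_zero |>.1 (right_ne_zero_of_mul ht.ne')
  refine inv_mul_log_le ht ((bootstrapOuter_le (fun f hf => (hL f (hΘ hf)).1) ha I hB hΩ₀).trans ?_)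
  rw [← ofReal_measureReal, mul_neg]
  exact ENNReal.ofReal_le_ofReal hp

variable {Υ : Type*} [MeasurableSpace Υ] {μ : Measure Υ} {X : ℕ → Υ → S}

theorem conditionalMDP_of_subset_admissible (hX : ∀ i, Measurable (X i))
    (hindep : Pairwise fun i j => X i ⟂ᵢ[μ] X j) (hlaw : ∀ i, μ.map (X i) = P)
    (ha : Tendsto a atTop (𝓝 0)) (hka : Tendsto (fun n => (k n : ℝ) * a n ^ 2) atTop atTop)
    (hΘ : Θ ⊆ admissible μ X P a) : ConditionalMDP μ X P k a Θ := by
  have hL : ∀ f ∈ admissible μ X P a, Measurable f ∧ MemLp f 2 P := fun f hf => ⟨hf.1, hf.2.1⟩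
  have ha₀ : ∀ᶠ n in atTop, a n ≠ 0 := (hka.eventually_gt_atTop 0).mono fun n hn =>
    pow_ne_zero_iff two_ne_zero |>.1 (right_ne_zero_of_mul hn.ne')
  have := isMeasurablyGenerated_typicalSamples P a fun f hf => (hL f hf).1
  have hsample (n : ℕ) : Measurable fun ω => (⟨n, sample X n ω⟩ : Σ n : ℕ, Fin n → S) :=
    (measurable_sigmaMk n).comp (measurable_sample hX n)
  have htypical (s) (hs : s ∈ typicalSamples P a (admissible μ X P a)) :
      ∀ᵐ ω ∂μ, ∀ᶠ n in atTop, (⟨n, sample X n ω⟩ : Σ n : ℕ, Fin n → S) ∈ s :=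
    ae_eventually_of_eventually_typicalSamples hX hindep hlaw ha ha₀ hs
  refine fun Ω₀ => ⟨?_, ?_⟩
  · exact liminfGeInnerAS_of_forall_lt hsample htypical fun r hr =>
      eventually_le_log_bootstrapInner hL hΘ hka hr
  · refine liminfGeInnerAS_of_forall_lt (z := fun p => -((((k p.1 * a p.1 ^ 2)⁻¹ : ℝ) : EReal) *
      ENNReal.log (bootstrapOuter p.2 (k p.1) (a p.1) Ω₀))) hsample htypical fun r hr => ?_
    rw [neg_neg] at hr
    filter_upwards [eventually_log_bootstrapOuter_le hL hΘ hka hr] with p hp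
    rwa [EReal.le_neg, ← EReal.coe_neg]

end ModerateDeviations

section FunctionClasses

variable {S : Type*} [MeasurableSpace S] {P : Measure S} {Υ : Type*} [MeasurableSpace Υ]
  {μ : Measure Υ} {X : ℕ → Υ → S} {a : ℕ → ℝ} {f : S → ℝ}

theorem memLp_of_mem_momentClass {t : ℝ} (ht : 0 < t) (hf : f ∈ momentClass P t) :
    MemLp f (ENNReal.ofReal t) P := by
  rw [← integrable_norm_rpow_iff hf.1.aestronglyMeasurable (by simpa using ht) (by simp),
    ENNReal.toReal_ofReal ht.le]
  exact hf.2

theorem ae_eventually_le_of_tsum_ne_top (hX : ∀ i, Measurable (X i))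
    (hlaw : ∀ i, μ.map (X i) = P) {g : ℕ → S → ℝ} (hg : ∀ n, Measurable (g n))
    (hsum : ∀ ε > 0, ∑' n, P {s | ε < g n s} ≠ ∞) :
    ∀ᵐ ω ∂μ, ∀ ε > 0, ∀ᶠ n in atTop, g n (X n ω) ≤ ε := by
  have hseq (m : ℕ) : ∀ᵐ ω ∂μ, ∀ᶠ n in atTop, g n (X n ω) ≤ 1 / ((m : ℝ) + 1) := by
    have hprob (n : ℕ) : μ (X n ⁻¹' {s | 1 / ((m : ℝ) + 1) < g n s}) =
        P {s | 1 / ((m : ℝ) + 1) < g n s} := by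
      rw [← hlaw n, Measure.map_apply (hX n) (measurableSet_lt measurable_const (hg n))]
    have hsum_m := hsum _ (Nat.one_div_pos_of_nat (n := m))
    simp_rw [← hprob] at hsum_m
    simpa using ae_eventually_notMem hsum_m
  filter_upwards [ae_all_iff.2 hseq] with ω hω ε hε
  obtain ⟨m, hm⟩ := exists_nat_one_div_lt hε
  exact (hω m).mono fun n hn => hn.trans hm.le

theorem ae_negligibleMaxima_of_tsum_ne_top (hX : ∀ i, Measurable (X i))
    (hlaw : ∀ i, μ.map (X i) = P) (ha : Tendsto a atTop (𝓝 0))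
    (ha_anti : AntitoneOn a (Set.Ici 1)) (hf : Measurable f)
    (hsum : ∀ ε > 0, ∑' n, P {s | ε < a (n + 1) * |f s|} ≠ ∞) :
    ∀ᵐ ω ∂μ, NegligibleMaxima a fun i => f (X i ω) :=
  (ae_eventually_le_of_tsum_ne_top hX hlaw (fun n => hf.abs.const_mul (a (n + 1))) hsum).mono
    fun _ => .of_antitoneOn ha ha_anti

theorem boundedClass_subset_admissible [IsFiniteMeasure P] (ha : Tendsto a atTop (𝓝 0)) :
    boundedClass S ⊆ admissible μ X P a := fun _ ⟨hf, _, hC⟩ =>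
  ⟨hf, .of_bound hf.aestronglyMeasurable _ (ae_of_all _ hC),
    ae_of_all _ fun _ => .of_forall_abs_le ha fun _ => hC _⟩

theorem tailClass_subset_admissible [IsFiniteMeasure P] (hX : ∀ i, Measurable (X i))
    (hlaw : ∀ i, μ.map (X i) = P) (ha : Tendsto a atTop (𝓝 0))
    (ha_anti : AntitoneOn a (Set.Ici 1)) {h : ℝ → ℝ}
    (hsum : ∀ c > 0, Summable fun n => h (c * a (n + 1))) :
    tailClass P 2 h ⊆ admissible μ X P a := fun f ⟨hf, hf_tail⟩ => by
  refine ⟨hf.1, by simpa using memLp_of_mem_momentClass two_pos hf,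
    ae_negligibleMaxima_of_tsum_ne_top hX hlaw ha ha_anti hf.1 fun ε hε => ?_⟩
  refine ne_top_of_le_ne_top (hsum ε⁻¹ (inv_pos.2 hε)).tsum_ofReal_ne_top
    (ENNReal.tsum_le_tsum fun n => ?_)
  rcases le_or_gt (a (n + 1)) 0 with ha_nonpos | ha_pos
  · have hempty : {s | ε < a (n + 1) * |f s|} = ∅ := Set.eq_empty_of_forall_notMem fun s hs =>
      (hε.trans hs).not_ge (mul_nonpos_of_nonpos_of_nonneg ha_nonpos (abs_nonneg _))
    simp [hempty]
  · have hset : {s | ε < a (n + 1) * |f s|} = {s | (ε⁻¹ * a (n + 1))⁻¹ < |f s|} := by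
      ext s
      rw [Set.mem_ofPred_eq, Set.mem_ofPred_eq, mul_inv, inv_inv, ← div_eq_mul_inv,
        div_lt_iff₀' ha_pos]
    rw [hset, ← ofReal_measureReal]
    exact ENNReal.ofReal_le_ofReal (hf_tail _ (by positivity)).le

theorem tsum_measure_lt_rpow_mul_abs_ne_top [IsProbabilityMeasure P] {t ε : ℝ} (ht : 0 < t)
    (hf : Integrable (fun s => |f s| ^ t) P) (hε : 0 < ε) :
    ∑' n : ℕ, P {s | ε < ((n + 1 : ℕ) : ℝ) ^ (-(1 / t)) * |f s|} ≠ ∞ := by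
  let _ : MeasureSpace S := ⟨P⟩
  have hfin := tsum_prob_mem_Ioi_lt_top (hf.const_mul (ε ^ t)⁻¹) fun s => by positivity
  refine ne_top_of_le_ne_top hfin.ne (ENNReal.tsum_le_tsum fun n => measure_mono fun s hs => ?_)
  have hn : (0 : ℝ) < (n + 1 : ℕ) := by positivity
  have hpow := Real.rpow_lt_rpow hε.le hs ht
  rw [Real.mul_rpow (by positivity) (abs_nonneg _), ← Real.rpow_mul hn.le, neg_mul,
    one_div_mul_cancel ht.ne', Real.rpow_neg_one, lt_inv_mul_iff₀ hn, mul_comm] at hpow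
  refine (Nat.cast_lt (α := ℝ).2 n.lt_succ_self).trans ?_
  rwa [lt_inv_mul_iff₀ (by positivity)]

theorem momentClass_subset_admissible [IsProbabilityMeasure P] (hX : ∀ i, Measurable (X i))
    (hlaw : ∀ i, μ.map (X i) = P) {t : ℝ} (ht : 2 ≤ t)
    (ha : a =O[atTop] fun n : ℕ => (n : ℝ) ^ (-(1 / t))) :
    momentClass P t ⊆ admissible μ X P a := fun f hf => by
  have ht_pos : 0 < t := two_pos.trans_le ht
  have ht_inv : 0 < 1 / t := one_div_pos.2 ht_pos
  have hzero : Tendsto (fun n : ℕ => (n : ℝ) ^ (-(1 / t))) atTop (𝓝 0) :=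
    (tendsto_rpow_neg_atTop ht_inv).comp tendsto_natCast_atTop_atTop
  have hanti : AntitoneOn (fun n : ℕ => (n : ℝ) ^ (-(1 / t))) (Set.Ici 1) := fun m hm n _ hmn =>
    Real.rpow_le_rpow_of_nonpos (Nat.cast_pos.2 hm) (Nat.cast_le.2 hmn) (neg_nonpos.2 ht_inv.le)
  have hmem : MemLp f 2 P := (memLp_of_mem_momentClass ht_pos hf).mono_exponent (by simpa using ht)
  exact ⟨hf.1, hmem, (ae_negligibleMaxima_of_tsum_ne_top hX hlaw hzero hanti hf.1 fun ε hε =>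
    tsum_measure_lt_rpow_mul_abs_ne_top ht_pos hf.2 hε).mono fun _ hω => hω.mono_isBigO ha⟩

end FunctionClasses

end BootstrapMDP

end

theorem mainTheorem1_general {S : Type*} [MeasurableSpace S] (P : Measure S)
    [IsProbabilityMeasure P] {Υ : Type*} [MeasurableSpace Υ] (μ : Measure Υ)
    (X : ℕ → Υ → S) (hX : ∀ i, Measurable (X i)) (hindep : Pairwise fun i j => X i ⟂ᵢ[μ] X j)
    (hlaw : ∀ i, μ.map (X i) = P) (k : ℕ → ℕ) (a : ℕ → ℝ) (ha_zero : Tendsto a atTop (𝓝 0))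
    (hka : Tendsto (fun n => (k n : ℝ) * a n ^ 2) atTop atTop) :
    (AntitoneOn a (Set.Ici 1) → ∀ h : ℝ → ℝ,
      (∀ c : ℝ, 0 < c → Summable (fun n : ℕ => h (c * a (n + 1)))) →
        BootstrapMDP.ConditionalMDP μ X P k a (BootstrapMDP.tailClass P 2 h) ∧
        BootstrapMDP.ConditionalMDP μ X P k a
          (BootstrapMDP.tailClass P 2 h ∪ BootstrapMDP.boundedClass S)) ∧
    (∀ t : ℝ, 2 ≤ t → a =O[atTop] (fun n : ℕ => (n : ℝ) ^ (-(1 / t))) →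
      BootstrapMDP.ConditionalMDP μ X P k a (BootstrapMDP.momentClass P t)) := by
  have hMDP {Θ : Set (S → ℝ)} (hΘ : Θ ⊆ BootstrapMDP.admissible μ X P a) :
      BootstrapMDP.ConditionalMDP μ X P k a Θ :=
    BootstrapMDP.conditionalMDP_of_subset_admissible hX hindep hlaw ha_zero hka hΘ
  refine ⟨fun ha_anti h hsum => ?_, fun t ht ha =>
    hMDP (BootstrapMDP.momentClass_subset_admissible hX hlaw ht ha)⟩
  have htail := BootstrapMDP.tailClass_subset_admissible hX hlaw ha_zero ha_anti hsum
  exact ⟨hMDP htail,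
    hMDP (Set.union_subset htail (BootstrapMDP.boundedClass_subset_admissible ha_zero))⟩

theorem mainTheorem1 {S : Type*} [TopologicalSpace S] [T2Space S] [MeasurableSpace S]
    [BorelSpace S] (P : Measure S) [IsProbabilityMeasure P]
    {Υ : Type*} [MeasurableSpace Υ] (μ : Measure Υ) [IsProbabilityMeasure μ]
    (X : ℕ → Υ → S) (hX : ∀ i, Measurable (X i)) (hindep : iIndepFun X μ)
    (hlaw : ∀ i, μ.map (X i) = P)
    (k : ℕ → ℕ) (hk : ∃ c : ℝ, ∀ n, 1 ≤ n → (k n : ℝ) / n < c) (hk_top : Tendsto k atTop atTop)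
    (a : ℕ → ℝ) (ha_pos : ∀ n, 1 ≤ n → 0 < a n) (ha_anti : AntitoneOn a (Set.Ici 1))
    (ha_zero : Tendsto a atTop (𝓝 0))
    (ha_ratio : Tendsto (fun n => a (n + 1) / a n) atTop (𝓝 1))
    (hka : Tendsto (fun n => (k n : ℝ) * a n ^ 2) atTop atTop) :
    (∀ h : ℝ → ℝ, (∀ s, 0 < s → 0 ≤ h s) →
      (∀ c : ℝ, 0 < c → Summable (fun n : ℕ => h (c * a (n + 1)))) →
        BootstrapMDP.ConditionalMDP μ X P k a (BootstrapMDP.tailClass P 2 h) ∧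
        BootstrapMDP.ConditionalMDP μ X P k a (BootstrapMDP.tailClass P 2 h ∪ BootstrapMDP.boundedClass S)) ∧
    (∀ t : ℝ, 2 < t → a =o[atTop] (fun n : ℕ => (n : ℝ) ^ (-(1 / t))) →
      BootstrapMDP.ConditionalMDP μ X P k a (BootstrapMDP.momentClass P t)) := by
  have hgeneral := mainTheorem1_general P μ X hX (fun _ _ => hindep.indepFun) hlaw k a ha_zero hka
  exact ⟨fun h _ => hgeneral.1 ha_anti h, fun t ht ha => hgeneral.2 t ht.le ha.isBigO⟩
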